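/- Let $k$ be an arbitrary field. A variety over $k$ is a separated, geometrically integral scheme of finite type over $k$. For a variety $X$ write $\mathrm{CH}(X)=\bigoplus_{r}\mathrm{CH}_r(X)$, where $\mathrm{CH}_r(X)$ is the group of $r$-dimensional cycles on $X$ modulo rational equivalence. **Theorem.** Let $X$ and $Y$ be smooth projective varieties over $k$, and let $f\colon X\to Y$ be a morphism over $k$. Suppose that the proper pushforward $f_*\colon \mathrm{CH}(X)\to \mathrm{CH}(Y)$ is an isomorphism. Then $f$ is an isomorphism. -/

import Mathlib

open CategoryTheory AlgebraicGeometry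

universe u

namespace ChowWhitehead

/-! ### Varieties over a field -/

section Varieties

variable (k : Type u) [Field k]

/-- A variety over `k` is a separated, geometrically integral scheme of finite type over `k`. -/
structure IsVariety (X : Over (Spec (CommRingCat.of k))) : Prop where
  separated : IsSeparated X.hom
  locallyOfFiniteType : LocallyOfFiniteType X.hom
  quasiCompact : QuasiCompact X.hom
  geometricallyIntegral : GeometricallyIntegral X.hom

attribute [local instance] MvPolynomial.gradedAlgebra

/-- The projective space `ℙⁿ` over `k`, i.e. `Proj k[x₀, …, xₙ]` with its structure morphism
`Proj k[x₀, …, xₙ] ⟶ Spec (k[x₀, …, xₙ])₀ ⟶ Spec k`. -/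
noncomputable def projectiveSpace (n : ℕ) : Over (Spec (CommRingCat.of k)) :=
  Over.mk (Proj.toSpecZero (MvPolynomial.homogeneousSubmodule (Fin (n + 1)) k) ≫
    Spec.map (CommRingCat.ofHom
      (algebraMap k (MvPolynomial.homogeneousSubmodule (Fin (n + 1)) k 0))))

/-- A `k`-scheme is projective if it is isomorphic over `k` to a closed subscheme of some `ℙⁿ`. -/
def IsProjective (X : Over (Spec (CommRingCat.of k))) : Prop :=
  ∃ (n : ℕ) (i : X ⟶ projectiveSpace k n), IsClosedImmersion i.left

/-- Smooth projective varieties over `k`. -/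
structure IsSmoothProjectiveVariety (X : Over (Spec (CommRingCat.of k))) : Prop
    extends IsVariety k X where
  smooth : Smooth X.hom
  projective : IsProjective k X

theorem projectiveSpace_isProper (n : ℕ) : IsProper (projectiveSpace k n).hom := by
  let A := MvPolynomial.homogeneousSubmodule (Fin (n + 1)) k
  have : Algebra.FiniteType (A 0) (MvPolynomial (Fin (n + 1)) k) :=
    have : IsScalarTower k (A 0) (MvPolynomial (Fin (n + 1)) k) :=
      ⟨fun a b c => by
        change (a • (b : MvPolynomial (Fin (n + 1)) k)) * c =
          a • ((b : MvPolynomial (Fin (n + 1)) k) * c)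
        exact smul_mul_assoc _ _ _⟩
    Algebra.FiniteType.of_restrictScalars_finiteType k _ _
  have hs : Function.Surjective (algebraMap k (A 0)) := by
    rintro ⟨p, hp⟩
    have hp' : p.IsHomogeneous 0 := hp
    refine ⟨p.coeff 0, Subtype.ext ?_⟩
    exact ((MvPolynomial.totalDegree_eq_zero_iff_eq_C).mp
      (Nat.le_zero.mp hp'.totalDegree_le)).symm
  have : IsClosedImmersion (Spec.map (CommRingCat.ofHom (algebraMap k (A 0)))) :=
    IsClosedImmersion.spec_of_surjective _ hs
  change IsProper (Proj.toSpecZero A ≫ Spec.map (CommRingCat.ofHom (algebraMap k (A 0))))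
  infer_instance

variable {k}

theorem IsProjective.isProper {X : Over (Spec (CommRingCat.of k))} (hX : IsProjective k X) :
    IsProper X.hom := by
  obtain ⟨n, i, hi⟩ := hX
  have := projectiveSpace_isProper k n
  rw [← Over.w i]
  infer_instance

/-- Every `k`-morphism between smooth projective varieties is proper. -/
theorem isProper_left {X Y : Over (Spec (CommRingCat.of k))} (hX : IsSmoothProjectiveVariety k X)
    (hY : IsSmoothProjectiveVariety k Y) (f : X ⟶ Y) : IsProper f.left := by
  have := hX.projective.isProper
  have := hY.separated
  have : IsProper (f.left ≫ Y.hom) := by rwa [Over.w f]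
  exact IsProper.of_comp f.left Y.hom

end Varieties

/-! ### Chow groups

A point `x` of a scheme corresponds to the integral closed subscheme `V` with generic point `x`.
In the specialization order generic points are large, so that `Order.height x` is the dimension of
the closure of `x` and `Order.coheight x` is its codimension. -/

/-- The group `Z_r(X)` of `r`-dimensional cycles on `X`. -/
def cycles (X : Scheme.{u}) (r : ℕ) : AddSubgroup (AlgebraicCycle X ℤ) where
  carrier := {c | ∀ x : X, c x ≠ 0 → Order.height x = r}
  zero_mem' := by simp
  add_mem' := by
    intro a b ha hb x hx
    by_cases h : a x = 0
    · refine hb x fun h' => hx ?_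
      simp [h, h']
    · exact ha x h
  neg_mem' := by
    intro a ha x hx
    exact ha x fun h => hx (by simp [h])

/-- `c` is the cycle of the divisor of the rational function `φ` on the integral closed
subscheme `i : V ⟶ X`: its coefficient at (the closure of) a point of codimension one of `V` is
the order of vanishing of `φ` there, and all its other coefficients are zero
(`Scheme.ord φ v = 0` unless `v` has codimension one in `V`). -/
def IsDivisorOf {X V : Scheme.{u}} [IsIntegral V] [IsLocallyNoetherian V] (i : V ⟶ X)
    (φ : V.functionField) (c : AlgebraicCycle X ℤ) : Prop :=
  (∀ v : V, c (i v) = Scheme.ord φ v) ∧ ∀ x : X, x ∉ Set.range i → c x = 0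

/-- The `r`-dimensional cycles rationally equivalent to zero: the subgroup generated by the
divisors of nonzero rational functions on `(r + 1)`-dimensional integral closed subschemes `V`
of `X`. (If `X` is locally Noetherian, then so is every such `V`.) -/
def ratEquivZero (X : Scheme.{u}) (r : ℕ) : AddSubgroup (cycles X r) :=
  AddSubgroup.closure {c | ∃ (V : Scheme.{u}) (_ : IsIntegral V) (_ : IsLocallyNoetherian V)
    (i : V ⟶ X) (_ : IsClosedImmersion i) (φ : V.functionField),
    Order.height (i (genericPoint V)) = ((r + 1 : ℕ) : ℕ∞) ∧ φ ≠ 0 ∧ IsDivisorOf i φ c.1}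

/-- The Chow group `CH_r(X)` of `r`-dimensional cycles modulo rational equivalence. -/
abbrev ChowGroup (X : Scheme.{u}) (r : ℕ) : Type u :=
  cycles X r ⧸ ratEquivZero X r

/-- The total Chow group `CH(X) = ⨁ᵣ CH_r(X)` (there are no cycles of negative dimension). -/
abbrev Chow (X : Scheme.{u}) : Type u :=
  DirectSum ℕ (ChowGroup X)

/-! ### Proper pushforward -/

section Pushforward

variable {X Y : Scheme.{u}} (f : X ⟶ Y) [IsProper f]

/-- The pushforward of cycles: `f_* [V] = [κ(V) : κ(f(V))] • [f(V)]` if `f(V)` has the same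
dimension as `V`, and `f_* [V] = 0` otherwise. -/
noncomputable def pushCycle (c : AlgebraicCycle X ℤ) : AlgebraicCycle Y ℤ :=
  AlgebraicCycle.map f (fun x : X => Order.height x) (fun y : Y => Order.height y) c

theorem pushCycle_apply (c : AlgebraicCycle X ℤ) (y : Y) :
    pushCycle f c y = ∑ᶠ x ∈ f ⁻¹' {y},
      c x * ((if Order.height x = Order.height (f x) then f.residueDegree x else 0 : ℕ) : ℤ) :=
  rfl

theorem pushCycle_add (a b : AlgebraicCycle X ℤ) :
    pushCycle f (a + b) = pushCycle f a + pushCycle f b := by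
  ext y
  obtain ⟨U, hU, hyU⟩ := (PrespectralSpace.isTopologicalBasis (X := Y)).exists_subset_of_mem_open
    (Set.mem_univ y) isOpen_univ
  have hfin (c : AlgebraicCycle X ℤ) : (f ⁻¹' {y} ∩ Function.support fun x => c x *
      ((if Order.height x = Order.height (f x) then f.residueDegree x else 0 : ℕ) : ℤ)).Finite := by
    refine (c.locallyFiniteSupport.finite_inter_support_of_isCompact
      (f.isSpectralMap.2 hU.1 hU.2)).subset ?_
    rintro x ⟨hx, hx'⟩
    refine ⟨?_, fun h => hx' ?_⟩
    swap
    · have h' : c x = 0 := h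
      simp [h']
    have : f x = y := hx
    simpa [this] using hyU.1
  have hadd : (pushCycle f a + pushCycle f b) y = pushCycle f a y + pushCycle f b y := rfl
  rw [hadd, pushCycle_apply, pushCycle_apply, pushCycle_apply,
    ← finsum_mem_add_distrib' (hfin a) (hfin b)]
  refine finsum_mem_congr rfl fun x _ => ?_
  have : (a + b) x = a x + b x := rfl
  rw [this, add_mul]

theorem pushCycle_mem {r : ℕ} {c : AlgebraicCycle X ℤ} (hc : c ∈ cycles X r) :
    pushCycle f c ∈ cycles Y r := by
  intro y hy
  rw [pushCycle_apply] at hy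
  obtain ⟨x, hx, hne⟩ := exists_ne_zero_of_finsum_mem_ne_zero hy
  have hxy : f x = y := hx
  have h1 : c x ≠ 0 := left_ne_zero_of_mul hne
  have h2 : Order.height x = Order.height (f x) := by
    by_contra h
    simp [h] at hne
  rw [← hxy, ← h2, hc x h1]

/-- The pushforward `f_* : Z_r(X) → Z_r(Y)` of `r`-dimensional cycles. -/
noncomputable def pushCycles (r : ℕ) : cycles X r →+ cycles Y r :=
  AddMonoidHom.mk' (fun c => ⟨pushCycle f c.1, pushCycle_mem f c.2⟩)
    fun a b => Subtype.ext (pushCycle_add f a.1 b.1)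

open Classical in
/-- The proper pushforward `f_* : CH_r(X) → CH_r(Y)`, `[c] ↦ [f_* c]`. Proper pushforward
preserves rational equivalence for schemes of finite type over a field, so that the condition
below is then satisfied; the value `0` is only there to make the definition total. -/
noncomputable def chowPushforward (r : ℕ) : ChowGroup X r →+ ChowGroup Y r :=
  if h : ratEquivZero X r ≤ (ratEquivZero Y r).comap (pushCycles f r) then
    QuotientAddGroup.map _ _ (pushCycles f r) h
  else 0

/-- The proper pushforward `f_* : CH(X) → CH(Y)` on total Chow groups. -/
noncomputable def pushforward : Chow X →+ Chow Y :=
  DirectSum.map (chowPushforward f)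

end Pushforward

end ChowWhitehead

/-!
# Morphisms inducing an isomorphism on Chow groups

Let `f : X ⟶ Y` be a morphism of smooth projective varieties with bijective pushforward on Chow
groups. Only the classes of dimension `dim X`, `dim Y` and `dim X - 1` matter.

In top dimension there is no rational equivalence (`ratEquivZero_eq_bot`), so comparing fundamental
classes shows that `dim X = dim Y` and that `f` has degree one, i.e. is birational
(`map_genericPoint_and_residueDegree_eq_one`).

The main point is that `f` contracts no prime divisor `E` of `X`. If it did, then `f_* [E] = 0`, so
`[E]` would be rationally equivalent to zero, i.e. the divisor of a rational function `φ`
(`exists_eq_ord_of_mem_ratEquivZero`). Over a point of codimension one of `Y` the proper birational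
morphism `f` is a local isomorphism, and no such point lies under `E`. Hence `φ`, seen as a rational
function on `Y`, has no zeros or poles in codimension one, and is a unit near `f(E)` because `Y` is
normal. So `φ` has order zero along `E`, a contradiction (`coheight_map_eq_one_of_ord`).

Thus `f` is a local isomorphism at every point of codimension one of `X`. The map
`f^* Ω_Y ⟶ Ω_X` of vector bundles is then an isomorphism in codimension one, hence everywhere, and
`f` is unramified (`formallyUnramified_of_height_one`). Being proper, it is finite by Zariski's main
theorem, and a finite birational morphism to a normal scheme is an isomorphism
(`isIso_of_isIntegralHom_of_functionFieldMap_surjective`).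

Instead of the dimension theory of varieties in general, only the following is used: points of
codimension one have dimension `dim X - 1` (`exists_height_genericPoint`).
-/

namespace ChowWhitehead

/-! ### Normal domains -/

section Normal

open nonZeroDivisors

/-- Algebraic Hartogs lemma: a fraction over a Noetherian normal domain which is regular at all
primes of height one is regular. If `a / b` were not regular, an associated prime of `A ⧸ (b)` would
contain all denominators of `a / b`; by normality such a prime has height one. -/
theorem exists_algebraMap_eq_of_height_one {A K : Type*} [CommRing A] [IsDomain A]
    [IsNoetherianRing A] [IsIntegrallyClosed A] [Field K] [Algebra A K] [IsFractionRing A K]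
    (x : K) (hx : ∀ p : Ideal A, p.IsPrime → p.height = 1 →
      ∃ s ∉ p, ∃ a, algebraMap A K s * x = algebraMap A K a) :
    ∃ a, algebraMap A K a = x := by
  obtain ⟨a, b, hb, rfl⟩ := IsFractionRing.div_surjective A x
  have hb0 : b ≠ 0 := nonZeroDivisors.ne_zero hb
  have hinj := IsFractionRing.injective A K
  have hb' : algebraMap A K b ≠ 0 := (map_ne_zero_iff _ hinj).mpr hb0
  have key (s c : A) : s * c ∈ Ideal.span {b} ↔
      ∃ t, algebraMap A K s * (algebraMap A K c / algebraMap A K b) = algebraMap A K t := by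
    rw [Ideal.mem_span_singleton']
    refine exists_congr fun t => ?_
    rw [← hinj.eq_iff, map_mul, map_mul]
    field_simp
    exact eq_comm
  by_contra! hne
  have ha : (Ideal.Quotient.mk (Ideal.span {b}) a) ≠ 0 := by
    rw [Ne, Ideal.Quotient.eq_zero_iff_mem]
    intro h
    rw [← one_mul a, key] at h
    obtain ⟨t, ht⟩ := h
    exact hne t (by rw [← ht, map_one, one_mul])
  obtain ⟨P, hPass, hle⟩ := exists_le_isAssociatedPrime_of_isNoetherianRing A _ ha
  obtain ⟨hP, y, hy⟩ := isAssociatedPrime_iff.mp hPass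
  obtain ⟨c, rfl⟩ := Ideal.Quotient.mk_surjective y
  have hmem (c s : A) : s ∈ (⊥ : Submodule A (A ⧸ Ideal.span {b})).colon
      {Ideal.Quotient.mk (Ideal.span {b}) c} ↔
      ∃ t, algebraMap A K s * (algebraMap A K c / algebraMap A K b) = algebraMap A K t := by
    rw [← key, Submodule.mem_colon_singleton, Submodule.mem_bot,
      ← Ideal.Quotient.eq_zero_iff_mem, map_mul]
    rfl
  -- `P` is the ideal of denominators of the fraction `c / b`.
  have hPmem (s : A) : s ∈ P ↔
      ∃ t, algebraMap A K s * (algebraMap A K c / algebraMap A K b) = algebraMap A K t := by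
    rw [hy, hmem]
  set z : K := algebraMap A K c / algebraMap A K b with hz
  -- As `A` is normal, multiplication by `c / b` does not map `P` to itself.
  have hex : ∃ s ∈ P, ∃ t ∉ P, algebraMap A K s * z = algebraMap A K t := by
    by_contra! hall
    have hint : IsIntegral A z := by
      refine isIntegral_of_smul_mem_submodule (Submodule.map (Algebra.linearMap A K) P) ?_ ?_ z ?_
      · intro h
        have hbP : b ∈ P := (hPmem b).mpr ⟨c, by rw [hz]; field_simp⟩
        have : algebraMap A K b ∈ Submodule.map (Algebra.linearMap A K) P := ⟨b, hbP, rfl⟩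
        rw [h, Submodule.mem_bot] at this
        exact hb' this
      · exact (IsNoetherian.noetherian P).map _
      · rintro _ ⟨s, hs, rfl⟩
        obtain ⟨t, ht⟩ := (hPmem s).mp hs
        refine ⟨t, by_contra fun htP => hall s hs t htP ht, ?_⟩
        rw [Algebra.linearMap_apply, Algebra.linearMap_apply, ← ht, smul_eq_mul, mul_comm]
    obtain ⟨t, ht⟩ := IsIntegrallyClosed.isIntegral_iff.mp hint
    exact hP.ne_top ((Ideal.eq_top_iff_one _).mpr ((hPmem 1).mpr ⟨t, by rw [ht, map_one, one_mul]⟩))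
  obtain ⟨s, hs, t, ht, hst⟩ := hex
  have hs0 : s ≠ 0 := by
    rintro rfl
    rw [map_zero, zero_mul, eq_comm, map_eq_zero_iff _ hinj] at hst
    exact ht (hst ▸ P.zero_mem)
  -- Every `r ∈ P` satisfies `r * t = s * r'` with `t ∉ P`, so that `P` is minimal over `s`.
  have hmin : P ∈ (Ideal.span {s}).minimalPrimes := by
    refine ⟨⟨hP, (Ideal.span_singleton_le_iff_mem _).mpr hs⟩, fun Q ⟨hQ, hsQ⟩ hQP r hr => ?_⟩
    obtain ⟨r', hr'⟩ := (hPmem r).mp hr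
    have : r * t = s * r' := hinj <| by
      rw [map_mul, map_mul, ← hst, ← hr']
      ring
    refine (hQ.mem_or_mem (?_ : r * t ∈ Q)).resolve_right fun h => ht (hQP h)
    rw [this]
    exact Q.mul_mem_right _ ((Ideal.span_singleton_le_iff_mem _).mp hsQ)
  have hheight : P.height = 1 := by
    refine le_antisymm (Ideal.height_le_one_of_isPrincipal_of_mem_minimalPrimes _ _ hmin) ?_
    rw [Order.one_le_iff_ne_zero, Ne, Ideal.height_eq_zero_iff_eq_bot]
    rintro rfl
    exact hs0 hs
  obtain ⟨u, huP, v, huv⟩ := hx P hP hheight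
  exact huP (hle ((hmem a u).mpr ⟨v, huv⟩))

/-- A domain which is étale over a normal domain is normal, since integral closure commutes with
étale base change. -/
theorem isIntegrallyClosed_of_etale {R S : Type*} [CommRing R] [IsDomain R]
    [IsIntegrallyClosed R] [CommRing S] [IsDomain S] [Algebra R S] [Algebra.Etale R S] :
    IsIntegrallyClosed S := by
  let K := FractionRing R
  let T := TensorProduct R S K
  have hinj : Function.Injective (algebraMap R S) := by
    rw [injective_iff_map_eq_zero]
    intro r hr
    by_contra h0
    have hflat : Module.Flat R S := inferInstance
    have := (hflat.isSMulRegular_of_isRegular (IsRegular.of_ne_zero h0))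
    exact one_ne_zero (this (by simp [Algebra.smul_def, hr] : r • (1 : S) = r • 0))
  have hM : Algebra.algebraMapSubmonoid S R⁰ ≤ S⁰ :=
    map_le_nonZeroDivisors_of_injective _ hinj le_rfl
  have hloc : IsLocalization (Algebra.algebraMapSubmonoid S R⁰) T := inferInstance
  have : IsDomain T := IsLocalization.isDomain_of_le_nonZeroDivisors _ hM
  let e : T ≃ₐ[R] TensorProduct R K S := Algebra.TensorProduct.comm R S K
  have : IsDomain (TensorProduct R K S) := e.symm.toMulEquiv.isDomain
  have : Module.Finite K (TensorProduct R K S) :=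
    Algebra.FormallyUnramified.finite_of_free K (TensorProduct R K S)
  have hT : IsField T := e.toMulEquiv.isField
    (isField_of_isIntegral_of_isField' (R := K) (Field.toIsField K))
  let _ := hT.toField
  have : IsFractionRing S T := by
    refine IsLocalization.of_le (Algebra.algebraMapSubmonoid S R⁰) S⁰ hM fun s hs => ?_
    rw [isUnit_iff_ne_zero, map_ne_zero_iff _ (IsLocalization.injective T hM)]
    exact nonZeroDivisors.ne_zero hs
  rw [isIntegrallyClosed_iff T]
  intro x hx
  obtain ⟨w, hw⟩ := (TensorProduct.toIntegralClosure_bijective_of_smooth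
    (R := R) (S := S) (B := K)).2 ⟨x, hx⟩
  suffices ∀ w, ∃ y, algebraMap S T y = TensorProduct.toIntegralClosure R S K w by
    obtain ⟨y, h⟩ := this w
    exact ⟨y, by rw [h, hw]⟩
  intro w
  induction w with
  | zero => exact ⟨0, by simp⟩
  | add a b ha hb =>
    obtain ⟨a', ha'⟩ := ha
    obtain ⟨b', hb'⟩ := hb
    exact ⟨a' + b', by rw [map_add, ha', hb']; simp⟩
  | tmul s r =>
    obtain ⟨r', hr'⟩ := IsIntegrallyClosed.isIntegral_iff.mp r.2
    refine ⟨r' • s, ?_⟩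
    trans s ⊗ₜ[R] (r : K)
    · rw [← hr', ← mul_one (algebraMap R K r'), ← Algebra.smul_def, TensorProduct.tmul_smul,
        TensorProduct.smul_tmul']
      rfl
    · simp [TensorProduct.toIntegralClosure]

/-- A domain which is smooth over a field is normal: locally it is étale over a polynomial ring. -/
theorem isIntegrallyClosed_of_smooth {k A : Type*} [Field k] [CommRing A] [IsDomain A]
    [Algebra k A] [Algebra.Smooth k A] : IsIntegrallyClosed A := by
  refine IsIntegrallyClosed.of_localization_maximal fun p _ hp => ?_
  obtain ⟨f, hf, n, _, _, _⟩ := Algebra.IsSmoothAt.exists_isStandardEtale_mvPolynomial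
    (R := k) (p := p)
  have hf0 : f ≠ 0 := fun h => hf (h ▸ p.zero_mem)
  have hle : Submonoid.powers f ≤ A⁰ := powers_le_nonZeroDivisors_of_noZeroDivisors hf0
  have : IsDomain (Localization.Away f) := IsLocalization.isDomain_of_le_nonZeroDivisors _ hle
  have : IsIntegrallyClosed (Localization.Away f) :=
    isIntegrallyClosed_of_etale (R := MvPolynomial (Fin n) k)
  have hle' : Submonoid.powers f ≤ p.primeCompl := Submonoid.powers_le.mpr hf
  let _ : Algebra (Localization.Away f) (Localization.AtPrime p) :=
    IsLocalization.localizationAlgebraOfSubmonoidLe _ _ _ _ hle'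
  have : IsScalarTower A (Localization.Away f) (Localization.AtPrime p) :=
    IsLocalization.localization_isScalarTower_of_submonoid_le _ _ _ _ hle'
  have := IsLocalization.isLocalization_of_submonoid_le (Localization.Away f)
    (Localization.AtPrime p) _ _ hle'
  refine isIntegrallyClosed_of_isLocalization (R := Localization.Away f) _
    (p.primeCompl.map (algebraMap A (Localization.Away f))) ?_
  exact map_le_nonZeroDivisors_of_injective _ (IsLocalization.injective _ hle)
    p.primeCompl_le_nonZeroDivisors

end Normal

/-! ### A criterion for being unramified -/

section Unramified

open scoped TensorProduct nonZeroDivisors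

/-- If `A ⊆ B ⊆ Frac A` and `Ω[A⁄k]` is flat, then `B ⊗[A] Ω[A⁄k] ⟶ Ω[B⁄k]` is injective, because
it becomes an isomorphism over `Frac A`. -/
theorem mapBaseChange_injective_of_isFractionRing {k A B : Type*} (K : Type*) [CommRing k]
    [CommRing A] [IsDomain A] [CommRing B] [Field K] [Algebra k A] [Algebra k B] [Algebra A B]
    [IsScalarTower k A B] [Algebra k K] [Algebra A K] [Algebra B K] [IsScalarTower A B K]
    [IsScalarTower k A K] [IsScalarTower k B K] [IsFractionRing A K]
    (hBK : Function.Injective (algebraMap B K)) [Module.Flat A Ω[A⁄k]] :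
    Function.Injective (KaehlerDifferential.mapBaseChange k A B) := by
  have : Algebra.FormallyEtale A K := Algebra.FormallyEtale.of_isLocalization A⁰
  let φ := LinearMap.rTensor Ω[A⁄k] (IsScalarTower.toAlgHom A B K).toLinearMap
  have hφ : Function.Injective φ := Module.Flat.rTensor_preserves_injective_linearMap _ hBK
  have hcomm (z : B ⊗[A] Ω[A⁄k]) : KaehlerDifferential.map k k B K
      (KaehlerDifferential.mapBaseChange k A B z) =
      KaehlerDifferential.tensorKaehlerEquivOfFormallyEtale k A K (φ z) := by
    induction z with
    | zero => simp
    | add x y hx hy => simp only [map_add, hx, hy]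
    | tmul b ω =>
      have hω : KaehlerDifferential.map k k B K (KaehlerDifferential.map k k A B ω) =
          KaehlerDifferential.map k k A K ω := by
        have : ω ∈ Submodule.span A (Set.range (KaehlerDifferential.D k A)) := by
          rw [KaehlerDifferential.span_range_derivation]; trivial
        induction this using Submodule.span_induction with
        | mem x hx =>
          obtain ⟨a, rfl⟩ := hx
          simp [← IsScalarTower.algebraMap_apply]
        | zero => simp
        | add x y _ _ hx hy => simp only [map_add, hx, hy]
        | smul a x _ hx =>
          rw [map_smul, LinearMap.map_smul_of_tower, hx, map_smul]
      rw [KaehlerDifferential.tensorKaehlerEquivOfFormallyEtale_apply,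
        KaehlerDifferential.mapBaseChange_tmul, map_smul, hω]
      simp [φ]
  intro x y hxy
  refine hφ ((KaehlerDifferential.tensorKaehlerEquivOfFormallyEtale k A K).injective ?_)
  rw [← hcomm, ← hcomm, hxy]

/-- Hartogs for modules: an injective map from a projective module to a torsion-free module over a
Noetherian normal domain is surjective if it is so generically and at all primes of height one. -/
theorem surjective_of_height_one {B M N : Type*} [CommRing B] [IsDomain B] [IsNoetherianRing B]
    [IsIntegrallyClosed B] [AddCommGroup M] [Module B M] [Module.Projective B M]
    [AddCommGroup N] [Module B N] [Module.IsTorsionFree B N] (α : M →ₗ[B] N)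
    (hα : Function.Injective α) (hgen : ∀ n : N, ∃ b : B, b ≠ 0 ∧ b • n ∈ LinearMap.range α)
    (h : ∀ p : Ideal B, p.IsPrime → p.height = 1 → ∀ n : N, ∃ c ∉ p,
      c • n ∈ LinearMap.range α) : Function.Surjective α := by
  intro n
  obtain ⟨b, hb0, m, hm⟩ := hgen n
  obtain ⟨s, hs⟩ := Module.projective_def.mp (inferInstance : Module.Projective B M)
  -- `b` divides every coordinate of `m`, since it does so at each prime of height one.
  have hdvd (x : M) : ∃ r : B, b * r = s m x := by
    let K := FractionRing B
    have hb : algebraMap B K b ≠ 0 := by simpa using hb0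
    obtain ⟨r, hr⟩ := exists_algebraMap_eq_of_height_one (A := B) (K := K)
      (algebraMap B K (s m x) / algebraMap B K b) fun p hp hp1 => by
        obtain ⟨c, hc, m', hm'⟩ := h p hp hp1 n
        refine ⟨c, hc, s m' x, ?_⟩
        have hcm : c • m = b • m' := hα (by rw [map_smul, map_smul, hm, hm', smul_comm])
        have : c * s m x = b * s m' x := by
          simpa using congrArg (fun z => s z x) hcm
        rw [← mul_div_assoc, ← map_mul, this, map_mul, mul_div_cancel_left₀ _ hb]
    refine ⟨r, IsFractionRing.injective B K ?_⟩
    rw [map_mul, hr, mul_div_cancel₀ _ hb]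
  choose r hr using hdvd
  refine ⟨(s m).sum fun x _ => r x • x, ?_⟩
  refine smul_right_injective N hb0 ?_
  change b • α _ = b • n
  rw [← hm, ← map_smul, Finsupp.smul_sum]
  congr 1
  conv_rhs => rw [← hs m, Finsupp.linearCombination_apply]
  refine Finsupp.sum_congr fun x _ => ?_
  rw [smul_smul, hr, id]

/-- Purity for birational extensions `A ⊆ B` of smooth `k`-algebras: if `A ⟶ B` is a local
isomorphism at the primes of height one of `B`, then it is unramified. The hypothesis says that the
map `B ⊗[A] Ω[A⁄k] ⟶ Ω[B⁄k]` of projective modules is surjective in codimension one, hence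
surjective, so that its cokernel `Ω[B⁄A]` vanishes. -/
theorem formallyUnramified_of_height_one {k A B : Type*} (K : Type*) [CommRing k] [CommRing A]
    [IsDomain A] [CommRing B] [IsDomain B] [IsNoetherianRing B] [IsIntegrallyClosed B] [Field K]
    [Algebra k A] [Algebra k B] [Algebra A B] [IsScalarTower k A B] [Algebra k K] [Algebra A K]
    [Algebra B K] [IsScalarTower A B K] [IsScalarTower k A K] [IsScalarTower k B K]
    [IsFractionRing A K] [IsFractionRing B K] [Algebra.FormallySmooth k A]
    [Algebra.FormallySmooth k B]
    (h : ∀ p : Ideal B, p.IsPrime → p.height = 1 →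
      ∀ b : B, ∃ s a : A, algebraMap A B s ∉ p ∧ algebraMap A B s * b = algebraMap A B a) :
    Algebra.FormallyUnramified A B := by
  have hA : Module.Projective A Ω[A⁄k] := Algebra.FormallySmooth.projective_kaehlerDifferential
  have hB : Module.Projective B Ω[B⁄k] := Algebra.FormallySmooth.projective_kaehlerDifferential
  have hrange (p : Ideal B) (hp : p.IsPrime)
      (hfrac : ∀ b : B, ∃ s a : A, algebraMap A B s ∉ p ∧ algebraMap A B s * b = algebraMap A B a)
      (ω : Ω[B⁄k]) : ∃ c ∉ p,
        c • ω ∈ LinearMap.range (KaehlerDifferential.mapBaseChange k A B) := by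
    have : ω ∈ Submodule.span B (Set.range (KaehlerDifferential.D k B)) := by
      rw [KaehlerDifferential.span_range_derivation]; trivial
    induction this using Submodule.span_induction with
    | zero => exact ⟨1, p.one_notMem, by simp⟩
    | mem x hx =>
      obtain ⟨b, rfl⟩ := hx
      obtain ⟨s, a, hs, hsa⟩ := hfrac b
      refine ⟨_, hs, 1 ⊗ₜ KaehlerDifferential.D k A a - b ⊗ₜ KaehlerDifferential.D k A s, ?_⟩
      simp [← hsa]
    | add x y _ _ hx hy =>
      obtain ⟨c, hc, hcx⟩ := hx
      obtain ⟨d, hd, hdy⟩ := hy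
      refine ⟨c * d, hp.mul_notMem hc hd, ?_⟩
      rw [smul_add, mul_comm, mul_smul, mul_comm, mul_smul]
      exact Submodule.add_mem _ (Submodule.smul_mem _ _ hcx) (Submodule.smul_mem _ _ hdy)
    | smul b x _ hx =>
      obtain ⟨c, hc, hcx⟩ := hx
      exact ⟨c, hc, by rw [smul_comm]; exact Submodule.smul_mem _ _ hcx⟩
  refine ⟨?_⟩
  have hsurj : Function.Surjective (KaehlerDifferential.mapBaseChange k A B) := by
    refine surjective_of_height_one _ (mapBaseChange_injective_of_isFractionRing K
      (IsFractionRing.injective B K)) (fun n => ?_) fun p hp hp1 => hrange p hp (h p hp hp1)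
    refine hrange ⊥ Ideal.isPrime_bot (fun b => ?_) n
    obtain ⟨a, s, hs, has⟩ := IsFractionRing.div_surjective A (algebraMap B K b)
    have hs0 : algebraMap A K s ≠ 0 := by simpa using nonZeroDivisors.ne_zero hs
    refine ⟨s, a, ?_, IsFractionRing.injective B K ?_⟩
    · rw [Ideal.mem_bot]
      intro h0
      rw [IsScalarTower.algebraMap_apply A B K, h0, map_zero] at hs0
      exact hs0 rfl
    · rw [map_mul, ← has, ← IsScalarTower.algebraMap_apply, ← IsScalarTower.algebraMap_apply,
        mul_div_cancel₀ _ hs0]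
  refine ⟨fun x y => ?_⟩
  suffices ∀ x : Ω[B⁄A], x = 0 by rw [this x, this y]
  intro x
  obtain ⟨ω, rfl⟩ := KaehlerDifferential.map_surjective k A B x
  obtain ⟨z, rfl⟩ := hsurj ω
  exact (KaehlerDifferential.exact_mapBaseChange_map k A B).apply_apply_eq_zero z

end Unramified

/-! ### Dimension theory of finitely generated domains over a field -/

theorem height_eq_of_isMaximal_mvPolynomial (k : Type*) [Field k] (n : ℕ)
    (m : Ideal (MvPolynomial (Fin n) k)) [m.IsMaximal] : m.height = n := by
  induction n with
  | zero =>
    refine le_antisymm ?_ (zero_le)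
    have h := Ideal.height_le_ringKrullDim_of_ne_top (I := m) Ideal.IsPrime.ne_top'
    rw [MvPolynomial.ringKrullDim_of_isNoetherianRing, ringKrullDim_eq_zero_of_field] at h
    simpa using h
  | succ n ih =>
    let e := (MvPolynomial.finSuccEquiv k n).toRingEquiv
    let M : Ideal (Polynomial (MvPolynomial (Fin n) k)) := m.comap e.symm
    have hM : M.IsMaximal := Ideal.comap_isMaximal_of_equiv e.symm
    have h1 : M.height = m.height := e.symm.height_comap m
    have : (M.comap (Polynomial.C (R := MvPolynomial (Fin n) k))).IsMaximal :=
      Polynomial.isMaximal_comap_C_of_isJacobsonRing M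
    have : M.LiesOver (M.comap (Polynomial.C (R := MvPolynomial (Fin n) k))) := ⟨rfl⟩
    rw [← h1, Polynomial.height_eq_height_add_one (M.comap Polynomial.C) M, ih]
    push_cast
    rfl

theorem le_ringKrullDim_quotient_mvPolynomial (k : Type*) [Field k] (n : ℕ)
    (p : Ideal (MvPolynomial (Fin n) k)) [p.IsPrime] (hp : p.height = 1) :
    (n : WithBot ℕ∞) ≤ ringKrullDim (MvPolynomial (Fin n) k ⧸ p) + 1 := by
  obtain ⟨⟨g, rfl⟩⟩ := UniqueFactorizationMonoid.isPrincipal_of_height_eq_one hp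
  obtain ⟨m, hm, hle⟩ := Ideal.exists_le_maximal _ (Ideal.IsPrime.ne_top ‹_›)
  have h := Ideal.height_le_ringKrullDim_quotient_add_one (hle (Ideal.mem_span_singleton_self g))
  rw [height_eq_of_isMaximal_mvPolynomial] at h
  exact h

theorem trdeg_eq_of_isAlgebraic (k : Type*) {A B : Type u} [Field k] [CommRing A] [IsDomain A]
    [CommRing B] [IsDomain B] [Algebra k A] [Algebra k B] [Algebra A B] [IsScalarTower k A B]
    [FaithfulSMul A B] [Algebra.IsAlgebraic A B] : Algebra.trdeg k A = Algebra.trdeg k B := by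
  rw [← trdeg_add_eq (A := B) k A, trdeg_eq_zero (R := A) (A := B), add_zero]

/-- The dimension of a finitely generated domain is its transcendence degree, and it drops by at
most one modulo a prime of height one. Both follow from Noether normalization, going down and the
case of polynomial rings, where primes of height one are principal. -/
theorem exists_ringKrullDim_eq_trdeg (k A : Type u) [Field k] [CommRing A] [IsDomain A]
    [Algebra k A] [Algebra.FiniteType k A] :
    ∃ n : ℕ, ringKrullDim A = n ∧ Algebra.trdeg k A = n ∧
      ∀ p : Ideal A, p.IsPrime → p.height = 1 →
        (n : WithBot ℕ∞) ≤ ringKrullDim (A ⧸ p) + 1 := by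
  have main (A : Type u) [CommRing A] [IsDomain A] [Algebra k A] [Algebra.FiniteType k A]
      (n : ℕ) [Algebra (MvPolynomial (Fin n) k) A] [IsScalarTower k (MvPolynomial (Fin n) k) A]
      [FaithfulSMul (MvPolynomial (Fin n) k) A] [Algebra.IsIntegral (MvPolynomial (Fin n) k) A] :
      ringKrullDim A = n ∧ Algebra.trdeg k A = n := by
    constructor
    · apply le_antisymm
      · calc ringKrullDim A ≤ ringKrullDim (MvPolynomial (Fin n) k) :=
              Order.krullDim_le_of_strictMono
                (PrimeSpectrum.comap (algebraMap (MvPolynomial (Fin n) k) A)) fun I J hIJ =>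
                  Ideal.IsIntegral.comap_lt_comap hIJ
          _ = n := by simp
      · obtain ⟨M, hM⟩ := Ideal.exists_maximal A
        have := Ideal.isMaximal_comap_of_isIntegral_of_isMaximal (R := MvPolynomial (Fin n) k) M
        have : M.LiesOver (M.comap (algebraMap (MvPolynomial (Fin n) k) A)) := ⟨rfl⟩
        have : IsNoetherianRing A := Algebra.FiniteType.isNoetherianRing k A
        refine le_trans ?_ (Ideal.height_le_ringKrullDim_of_ne_top (I := M) hM.ne_top)
        rw [Ideal.height_eq_height_add_of_liesOver_of_hasGoingDown
          (M.comap (algebraMap (MvPolynomial (Fin n) k) A)) M,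
          height_eq_of_isMaximal_mvPolynomial]
        exact_mod_cast le_self_add
    · rw [← trdeg_eq_of_isAlgebraic k (A := MvPolynomial (Fin n) k) (B := A),
        MvPolynomial.trdeg_of_isDomain]
      simp
  have noether (A : Type u) [CommRing A] [IsDomain A] [Algebra k A] [Algebra.FiniteType k A] :
      ∃ (n : ℕ) (_ : Algebra (MvPolynomial (Fin n) k) A),
        IsScalarTower k (MvPolynomial (Fin n) k) A ∧ FaithfulSMul (MvPolynomial (Fin n) k) A ∧
        Algebra.IsIntegral (MvPolynomial (Fin n) k) A := by
    obtain ⟨n, g, hg, hg'⟩ := exists_integral_inj_algHom_of_fg k A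
    refine ⟨n, g.toRingHom.toAlgebra, ?_, ?_, ?_⟩
    · let _ := g.toRingHom.toAlgebra
      exact IsScalarTower.of_algebraMap_eq fun x => (g.commutes x).symm
    · let _ := g.toRingHom.toAlgebra
      exact (faithfulSMul_iff_algebraMap_injective _ _).mpr hg
    · let _ := g.toRingHom.toAlgebra
      exact ⟨hg'⟩
  obtain ⟨n, _, _, _, _⟩ := noether A
  refine ⟨n, (main A n).1, (main A n).2, fun P hP hP1 => ?_⟩
  let R := MvPolynomial (Fin n) k
  let p : Ideal R := P.comap (algebraMap R A)
  have : P.LiesOver p := ⟨rfl⟩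
  have : IsNoetherianRing A := Algebra.FiniteType.isNoetherianRing k A
  have hp1 : p.height = 1 := by
    have h := Ideal.height_eq_height_add_of_liesOver_of_hasGoingDown p P
    refine le_antisymm (hP1 ▸ h ▸ le_self_add) ?_
    rw [Order.one_le_iff_ne_zero, Ne, Ideal.height_eq_zero_iff_eq_bot]
    intro hbot
    have : P = ⊥ := Ideal.eq_bot_of_comap_eq_bot hbot
    rw [← Ideal.height_eq_zero_iff_eq_bot, hP1] at this
    exact one_ne_zero this
  have h := le_ringKrullDim_quotient_mvPolynomial k n p hp1
  obtain ⟨m, _, _, _, _⟩ := noether (R ⧸ p)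
  obtain ⟨l, _, _, _, _⟩ := noether (A ⧸ P)
  have htr : Algebra.trdeg k (R ⧸ p) = Algebra.trdeg k (A ⧸ P) := trdeg_eq_of_isAlgebraic k
  rw [(main (R ⧸ p) m).2, (main (A ⧸ P) l).2] at htr
  rw [(main (A ⧸ P) l).1]
  rw [(main (R ⧸ p) m).1] at h
  have : m = l := by exact_mod_cast htr
  rwa [this] at h

/-! ### Discrete valuation rings and orders of vanishing -/

/-- A valuation ring is maximal for domination: a local homomorphism to a local subring of its
fraction field is bijective. -/
theorem bijective_of_isLocalHom_of_valuationRing {R S K L : Type*} [CommRing R] [IsDomain R]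
    [ValuationRing R] [CommRing S] [IsLocalRing S] [Field K] [Field L] [Algebra R K]
    [IsFractionRing R K] [Algebra S L] [FaithfulSMul S L] (g : R →+* S) [IsLocalHom g]
    (σ : K →+* L) (hσ : Function.Surjective σ)
    (hcomm : ∀ r, σ (algebraMap R K r) = algebraMap S L (g r)) : Function.Bijective g := by
  have hS := FaithfulSMul.algebraMap_injective S L
  constructor
  · intro a b hab
    refine IsFractionRing.injective R K (σ.injective ?_)
    rw [hcomm, hcomm, hab]
  · intro s
    obtain ⟨z, hz⟩ := hσ (algebraMap S L s)
    obtain ⟨r, hr | hr⟩ := ValuationRing.isInteger_or_isInteger R z |>.elim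
      (fun ⟨r, hr⟩ => (⟨r, Or.inl hr⟩ : ∃ r : R, algebraMap R K r = z ∨ algebraMap R K r = z⁻¹))
      (fun ⟨r, hr⟩ => ⟨r, Or.inr hr⟩)
    · exact ⟨r, hS (by rw [← hcomm, hr, hz])⟩
    · by_cases hz0 : z = 0
      · exact ⟨0, hS (by rw [← hz, hz0, map_zero, map_zero, map_zero])⟩
      have h1 : g r * s = 1 := hS <| by
        rw [map_mul, ← hcomm, hr, ← hz, ← map_mul, inv_mul_cancel₀ hz0, map_one, map_one]
      have hu : IsUnit r := isUnit_of_map_unit g r (IsUnit.of_mul_eq_one _ h1)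
      obtain ⟨u, rfl⟩ := hu
      refine ⟨↑u⁻¹, ?_⟩
      calc g ↑u⁻¹ = g ↑u⁻¹ * (g u * s) := by rw [h1, mul_one]
        _ = s := by rw [← mul_assoc, ← map_mul, Units.inv_mul, map_one, one_mul]

theorem isDiscreteValuationRing_of_ringKrullDim_eq_one {R : Type*} [CommRing R] [IsDomain R]
    [IsLocalRing R] [IsNoetherianRing R] [IsIntegrallyClosed R] (h : ringKrullDim R = 1) :
    IsDiscreteValuationRing R := by
  have hf : ¬ IsField R := fun hf => by
    rw [ringKrullDim_eq_zero_of_isField hf] at h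
    exact zero_ne_one h
  have : Ring.KrullDimLE 1 R := Ring.krullDimLE_iff.mpr h.le
  have hm : IsLocalRing.maximalIdeal R ≠ ⊥ := IsLocalRing.isField_iff_maximalIdeal_eq.not.mp hf
  have hdvr : (IsIntegrallyClosed R ∧ ∃! P : Ideal R, P ≠ ⊥ ∧ P.IsPrime) →
      IsDiscreteValuationRing R := ((IsDiscreteValuationRing.TFAE R hf).out 3 0).mp
  refine hdvr ⟨inferInstance, IsLocalRing.maximalIdeal R, ⟨hm, inferInstance⟩, ?_⟩
  rintro P ⟨hP, hP'⟩
  exact IsLocalRing.eq_maximalIdeal (hP'.isMaximal_of_ne_bot hP)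

/-- Elements of order zero over a discrete valuation ring are units. The target of `Ring.ordFrac` is
multiplicative, so that order zero reads `Ring.ordFrac R x = 1`. -/
theorem exists_isUnit_algebraMap_eq_of_ordFrac_eq_one {R K : Type*} [CommRing R] [IsDomain R]
    [IsDiscreteValuationRing R] [Field K] [Algebra R K] [IsFractionRing R K] {x : K}
    (hx : Ring.ordFrac R x = 1) : ∃ r, IsUnit r ∧ algebraMap R K r = x := by
  obtain ⟨a, b, hb, rfl⟩ := IsFractionRing.div_surjective R x
  have hb0 : b ≠ 0 := nonZeroDivisors.ne_zero hb
  have ha0 : a ≠ 0 := by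
    rintro rfl
    simp at hx
  rw [map_div₀, Ring.ordFrac_eq_ord _ ha0, Ring.ordFrac_eq_ord _ hb0, div_eq_one_iff_eq] at hx
  · have ha := mem_nonZeroDivisors_of_ne_zero ha0
    have : Associated b a := by
      rw [← Ring.ord_eq_iff_associated]
      exact le_antisymm ((Ring.ord_le_iff hb ha).mpr hx.ge) ((Ring.ord_le_iff ha hb).mpr hx.le)
    obtain ⟨u, rfl⟩ := this
    refine ⟨u, u.isUnit, ?_⟩
    rw [map_mul, mul_div_cancel_left₀]
    simpa using hb0
  · exact Ring.ordMonoidWithZeroHom_ne_zero hb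

theorem ord_ringEquiv {R S : Type*} [CommRing R] [CommRing S] (e : R ≃+* S) (a : R) :
    Ring.ord S (e a) = Ring.ord R a := by
  let _ : Algebra R S := (e : R →+* S).toAlgebra
  let e' : R ≃ₐ[R] S := { e with commutes' := fun _ => rfl }
  rw [Ring.ord, Ring.ord, ← Module.length_eq_of_surjective (S := R) (R := S) e.surjective]
  refine (Ideal.quotientEquivAlg _ _ e' ?_).toLinearEquiv.length_eq.symm
  rw [Ideal.map_span, Set.image_singleton]
  rfl

theorem ordFrac_ringEquiv {R S K L : Type*} [CommRing R] [IsDomain R] [IsNoetherianRing R]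
    [Ring.KrullDimLE 1 R] [CommRing S] [IsDomain S] [IsNoetherianRing S] [Ring.KrullDimLE 1 S]
    [Field K] [Algebra R K] [IsFractionRing R K] [Field L] [Algebra S L] [IsFractionRing S L]
    (e : R ≃+* S) (σ : K →+* L) (hcomm : ∀ r, σ (algebraMap R K r) = algebraMap S L (e r))
    (x : K) : Ring.ordFrac S (σ x) = Ring.ordFrac R x := by
  obtain ⟨a, b, hb, rfl⟩ := IsFractionRing.div_surjective R x
  have hb0 : b ≠ 0 := nonZeroDivisors.ne_zero hb
  by_cases ha0 : a = 0
  · simp [ha0]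
  have key (a : R) (ha : a ≠ 0) : Ring.ordFrac S (algebraMap S L (e a)) =
      Ring.ordFrac R (algebraMap R K a) := by
    have hea : e a ≠ 0 := by simpa using ha
    rw [Ring.ordFrac_eq_ord _ ha, Ring.ordFrac_eq_ord _ hea,
      Ring.ordMonoidWithZeroHom_eq_ord (mem_nonZeroDivisors_of_ne_zero ha),
      Ring.ordMonoidWithZeroHom_eq_ord (mem_nonZeroDivisors_of_ne_zero hea), ord_ringEquiv]
  rw [map_div₀ σ, map_div₀, map_div₀, hcomm, hcomm, key a ha0, key b hb0]

/-! ### Points of affine open subschemes -/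

section AffinePoints

variable {X Y : Scheme.{u}}

/-- Every prime of the coordinate ring of an affine open `U` comes from a point of `U`, whose
codimension is the height of the prime. -/
theorem exists_point_of_isPrime {U : X.Opens} (hU : IsAffineOpen U) (p : Ideal Γ(X, U))
    [hp : p.IsPrime] : ∃ (x : X) (hx : x ∈ U), Order.coheight x = p.height ∧
      hU.primeIdealOf ⟨x, hx⟩ = ⟨p, hp⟩ := by
  let q : Spec Γ(X, U) := ⟨p, hp⟩
  have hmem : hU.fromSpec q ∈ U := by
    have : hU.fromSpec q ∈ hU.fromSpec.opensRange := ⟨_, rfl⟩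
    rwa [hU.opensRange_fromSpec] at this
  refine ⟨hU.fromSpec q, hmem, ?_, ?_⟩
  · exact (coheight_eq_of_isOpenImmersion hU.fromSpec).trans
      (idealHeight_eq_coheight Γ(X, U) q).symm
  · apply hU.fromSpec.isOpenEmbedding.injective
    exact hU.fromSpec_primeIdealOf _

theorem isUnit_germ_iff {U : X.Opens} (hU : IsAffineOpen U) (x : X) (hx : x ∈ U) (s : Γ(X, U)) :
    IsUnit (X.presheaf.germ U x hx s) ↔ s ∉ (hU.primeIdealOf ⟨x, hx⟩).asIdeal := by
  rw [hU.primeIdealOf_eq_map_closedPoint]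
  change _ ↔ ¬ (X.presheaf.germ U x hx s ∈ IsLocalRing.maximalIdeal _)
  rw [IsLocalRing.mem_maximalIdeal, mem_nonunits_iff, not_not]

/-- Germs on an affine open are fractions of sections. -/
theorem exists_germ_mul_eq {U : X.Opens} (hU : IsAffineOpen U) (x : X) (hx : x ∈ U)
    (t : X.presheaf.stalk x) : ∃ s a : Γ(X, U), IsUnit (X.presheaf.germ U x hx s) ∧
      X.presheaf.germ U x hx s * t = X.presheaf.germ U x hx a := by
  let _ := X.presheaf.algebra_section_stalk (⟨x, hx⟩ : U)
  have := hU.isLocalization_stalk ⟨x, hx⟩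
  obtain ⟨⟨a, s⟩, h⟩ := IsLocalization.surj (hU.primeIdealOf ⟨x, hx⟩).asIdeal.primeCompl t
  refine ⟨s, a, (isUnit_germ_iff hU x hx _).2 s.2, ?_⟩
  rw [mul_comm]
  exact h

theorem isIntegrallyClosed_stalk [IsIntegral X] {U : X.Opens} (hU : IsAffineOpen U)
    [IsIntegrallyClosed Γ(X, U)] (x : X) (hx : x ∈ U) :
    IsIntegrallyClosed (X.presheaf.stalk x) := by
  have : Nonempty U := ⟨⟨x, hx⟩⟩
  let _ := X.presheaf.algebra_section_stalk (⟨x, hx⟩ : U)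
  have := hU.isLocalization_stalk ⟨x, hx⟩
  exact isIntegrallyClosed_of_isLocalization (R := Γ(X, U)) (X.presheaf.stalk x)
    (hU.primeIdealOf ⟨x, hx⟩).asIdeal.primeCompl
    (hU.primeIdealOf ⟨x, hx⟩).asIdeal.primeCompl_le_nonZeroDivisors

/-- Algebraic Hartogs on an affine open `U` with normal coordinate ring. -/
theorem exists_germToFunctionField_eq [IsIntegral X] [IsLocallyNoetherian X] {U : X.Opens}
    (hU : IsAffineOpen U) [Nonempty U] [IsIntegrallyClosed Γ(X, U)] (φ : X.functionField)
    (h : ∀ x ∈ U, Order.coheight x = 1 →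
      ∃ t, algebraMap (X.presheaf.stalk x) X.functionField t = φ) :
    ∃ a : Γ(X, U), X.germToFunctionField U a = φ := by
  have := functionField_isFractionRing_of_isAffineOpen X U hU
  have : IsNoetherianRing Γ(X, U) := IsLocallyNoetherian.component_noetherian ⟨U, hU⟩
  refine exists_algebraMap_eq_of_height_one (A := Γ(X, U)) φ fun p hp hp1 => ?_
  obtain ⟨x, hx, hx1, hxp⟩ := exists_point_of_isPrime hU p
  obtain ⟨t, rfl⟩ := h x hx (hx1.trans hp1)
  obtain ⟨s, a, hs, hsa⟩ := exists_germ_mul_eq hU x hx t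
  rw [isUnit_germ_iff hU, hxp] at hs
  refine ⟨s, hs, a, ?_⟩
  have := congrArg (algebraMap (X.presheaf.stalk x) X.functionField) hsa
  rw [map_mul, Scheme.algebraMap_germ_eq_germToFunctionField,
    Scheme.algebraMap_germ_eq_germToFunctionField] at this
  exact this

end AffinePoints

/-! ### The induced map of function fields -/

section FunctionFieldMap

variable {X Y : Scheme.{u}} [IsIntegral X] [IsIntegral Y] (f : X ⟶ Y)

/-- The map of function fields induced by a morphism which maps the generic point to the
generic point. -/
noncomputable def functionFieldMap (h : f (genericPoint X) = genericPoint Y) :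
    Y.functionField ⟶ X.functionField :=
  Y.presheaf.stalkSpecializes (specializes_of_eq h) ≫ f.stalkMap (genericPoint X)

variable (h : f (genericPoint X) = genericPoint Y)

theorem functionFieldMap_algebraMap (x : X) (t : Y.presheaf.stalk (f x)) :
    (functionFieldMap f h).hom (algebraMap (Y.presheaf.stalk (f x)) Y.functionField t) =
      algebraMap (X.presheaf.stalk x) X.functionField ((f.stalkMap x).hom t) := by
  have e := Scheme.Hom.stalkSpecializes_stalkMap f (genericPoint X) x
    ((genericPoint_spec X).specializes trivial)
  rw [← Y.presheaf.stalkSpecializes_comp (specializes_of_eq h)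
    ((genericPoint_spec Y).specializes trivial), Category.assoc] at e
  exact DFunLike.congr_fun (CommRingCat.hom_ext_iff.mp e) t

theorem functionFieldMap_germToFunctionField (U : Y.Opens) [Nonempty U] [Nonempty (f ⁻¹ᵁ U)]
    (a : Γ(Y, U)) : (functionFieldMap f h).hom (Y.germToFunctionField U a) =
      X.germToFunctionField (f ⁻¹ᵁ U) ((f.app U).hom a) := by
  obtain ⟨x, hx⟩ := (inferInstance : Nonempty (f ⁻¹ᵁ U))
  rw [← Scheme.algebraMap_germ_eq_germToFunctionField Y (show f x ∈ U from hx),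
    functionFieldMap_algebraMap, ← Scheme.algebraMap_germ_eq_germToFunctionField X hx]
  congr 1
  exact Scheme.Hom.germ_stalkMap_apply f U x hx a

theorem functionFieldMap_germ (U : Y.Opens) (V : X.Opens) (e : V ≤ f ⁻¹ᵁ U) [Nonempty U]
    [Nonempty V] (a : Γ(Y, U)) : (functionFieldMap f h).hom (Y.germToFunctionField U a) =
      X.germToFunctionField V ((f.appLE U V e).hom a) := by
  have : Nonempty (f ⁻¹ᵁ U) := Nonempty.map (Set.inclusion e) ‹Nonempty V›
  rw [functionFieldMap_germToFunctionField]
  exact (X.presheaf.germ_res_apply (homOfLE e) _ _ _).symm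

end FunctionFieldMap

/-! ### Rings of sections of schemes over a field -/

section Sections

variable {k : Type u} [Field k] {X : Scheme.{u}} (p : X ⟶ Spec (CommRingCat.of k))

/-- The structure map `k ⟶ Γ(X, U)` for an open subset `U` of a `k`-scheme `X`. -/
noncomputable def sectionsMap (U : X.Opens) : CommRingCat.of k ⟶ Γ(X, U) :=
  (Scheme.ΓSpecIso (CommRingCat.of k)).inv ≫ p.appLE ⊤ U (le_top.trans_eq p.preimage_top.symm)

theorem sectionsMap_comp {X Y : Scheme.{u}} (q : Y ⟶ Spec (CommRingCat.of k)) (f : X ⟶ Y)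
    (U : Y.Opens) (V : X.Opens) (e : V ≤ f ⁻¹ᵁ U) :
    sectionsMap q U ≫ f.appLE U V e = sectionsMap (f ≫ q) V := by
  simp only [sectionsMap, Category.assoc]
  rw [Scheme.Hom.appLE_comp_appLE]

theorem sectionsMap_germ (U : X.Opens) (x : X) (hx : x ∈ U) :
    sectionsMap p U ≫ X.presheaf.germ U x hx = sectionsMap p ⊤ ≫ X.presheaf.germ ⊤ x trivial := by
  rw [← X.presheaf.germ_res (homOfLE (le_top : U ≤ ⊤)) x hx, sectionsMap, sectionsMap]
  simp only [Category.assoc]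
  rw [Scheme.Hom.appLE_map_assoc]

theorem sectionsMap_smooth [Smooth p] {U : X.Opens} (hU : IsAffineOpen U) :
    (sectionsMap p U).hom.Smooth := by
  rw [sectionsMap, CommRingCat.hom_comp]
  exact RingHom.Smooth.respectsIso.2 _
    (Scheme.ΓSpecIso (CommRingCat.of k)).symm.commRingCatIsoToRingEquiv
    (p.smooth_appLE (isAffineOpen_top _) hU fun _ _ => trivial)

theorem sectionsMap_finiteType [LocallyOfFiniteType p] {U : X.Opens} (hU : IsAffineOpen U) :
    (sectionsMap p U).hom.FiniteType := by
  rw [sectionsMap, CommRingCat.hom_comp]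
  exact RingHom.finiteType_respectsIso.2 _
    (Scheme.ΓSpecIso (CommRingCat.of k)).symm.commRingCatIsoToRingEquiv
    (p.finiteType_appLE (isAffineOpen_top _) hU fun _ _ => trivial)

theorem isIntegrallyClosed_sections [IsIntegral X] [Smooth p] {U : X.Opens} (hU : IsAffineOpen U)
    [Nonempty U] : IsIntegrallyClosed Γ(X, U) := by
  let _ : Algebra k Γ(X, U) := (sectionsMap p U).hom.toAlgebra
  have : Algebra.Smooth k Γ(X, U) := sectionsMap_smooth p hU
  exact isIntegrallyClosed_of_smooth (k := k)

theorem exists_isAffineOpen_mem (x : X) : ∃ U : X.Opens, IsAffineOpen U ∧ x ∈ U := by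
  obtain ⟨U, hU, hx, -⟩ := exists_isAffineOpen_mem_and_subset (U := ⊤) (x := x) trivial
  exact ⟨U, hU, hx⟩

/-- The local rings of a smooth integral scheme at points of codimension one are discrete valuation
rings. -/
theorem isDiscreteValuationRing_stalk [IsIntegral X] [IsLocallyNoetherian X] [Smooth p] (x : X)
    (hx : Order.coheight x = 1) : IsDiscreteValuationRing (X.presheaf.stalk x) := by
  obtain ⟨U, hU, hxU⟩ := exists_isAffineOpen_mem x
  have : Nonempty U := ⟨⟨x, hxU⟩⟩
  have := isIntegrallyClosed_sections p hU
  have := isIntegrallyClosed_stalk hU x hxU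
  apply isDiscreteValuationRing_of_ringKrullDim_eq_one
  rw [ringKrullDim_stalk_eq_coheight, hx]
  rfl

end Sections

/-! ### Dimension and codimension of points -/

section Heights

variable {k : Type u} [Field k] {X : Scheme.{u}}

/-- All nonempty affine opens of an integral scheme of finite type over a field have the same
dimension, namely the transcendence degree of the function field. Modulo a prime of height one it
drops by at most one. -/
theorem exists_ringKrullDim_sections_eq [IsIntegral X]
    (p : X ⟶ Spec (CommRingCat.of k)) [LocallyOfFiniteType p] :
    ∃ d : ℕ, ∀ U : X.Opens, IsAffineOpen U → Nonempty U → ringKrullDim Γ(X, U) = d ∧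
      ∀ P : Ideal Γ(X, U), P.IsPrime → P.height = 1 →
        (d : WithBot ℕ∞) ≤ ringKrullDim (Γ(X, U) ⧸ P) + 1 := by
  let _ : Algebra k X.functionField :=
    (sectionsMap p ⊤ ≫ X.presheaf.germ ⊤ (genericPoint X) trivial).hom.toAlgebra
  have key (U : X.Opens) (hU : IsAffineOpen U) (hne : Nonempty U) :
      ∃ n : ℕ, ringKrullDim Γ(X, U) = n ∧ Algebra.trdeg k X.functionField = n ∧
        ∀ P : Ideal Γ(X, U), P.IsPrime → P.height = 1 →
        (n : WithBot ℕ∞) ≤ ringKrullDim (Γ(X, U) ⧸ P) + 1 := by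
    let _ : Algebra k Γ(X, U) := (sectionsMap p U).hom.toAlgebra
    have : Algebra.FiniteType k Γ(X, U) := sectionsMap_finiteType p hU
    have := functionField_isFractionRing_of_isAffineOpen X U hU
    have : IsScalarTower k Γ(X, U) X.functionField := by
      apply IsScalarTower.of_algebraMap_eq'
      exact (CommRingCat.hom_ext_iff.mp (sectionsMap_germ p U (genericPoint X) _)).symm
    have : Algebra.IsAlgebraic Γ(X, U) X.functionField :=
      IsLocalization.isAlgebraic X.functionField (nonZeroDivisors Γ(X, U))
    rw [← trdeg_eq_of_isAlgebraic k (A := Γ(X, U)) (B := X.functionField)]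
    exact exists_ringKrullDim_eq_trdeg k Γ(X, U)
  obtain ⟨U₀, hU₀, h₀⟩ := exists_isAffineOpen_mem (genericPoint X)
  obtain ⟨d, -, hd, -⟩ := key U₀ hU₀ ⟨⟨_, h₀⟩⟩
  refine ⟨d, fun U hU hne => ?_⟩
  obtain ⟨n, h1, h2, h3⟩ := key U hU hne
  obtain rfl : n = d := by exact_mod_cast h2.symm.trans hd
  exact ⟨h1, h3⟩

theorem coheight_eq_height_primeIdealOf {U : X.Opens} (hU : IsAffineOpen U) (x : X)
    (hx : x ∈ U) : Order.coheight x = (hU.primeIdealOf ⟨x, hx⟩).asIdeal.height := by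
  have h := coheight_eq_of_isOpenImmersion hU.fromSpec (x := hU.primeIdealOf ⟨x, hx⟩)
  rw [idealHeight_eq_coheight Γ(X, U) (hU.primeIdealOf ⟨x, hx⟩), ← h]
  exact congrArg Order.coheight (hU.fromSpec_primeIdealOf ⟨x, hx⟩).symm

/-- Chains of primes containing the prime of `x` give chains of points in the closure of `x`. -/
theorem ringKrullDim_quotient_le_height {U : X.Opens} (hU : IsAffineOpen U) (x : X) (hx : x ∈ U) :
    ringKrullDim (Γ(X, U) ⧸ (hU.primeIdealOf ⟨x, hx⟩).asIdeal) ≤ Order.height x := by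
  rw [ringKrullDim_quotient, Order.height_eq_krullDim_Iic, ← Order.krullDim_orderDual]
  let Z := PrimeSpectrum.zeroLocus ((hU.primeIdealOf ⟨x, hx⟩).asIdeal : Set Γ(X, U))
  have hle (a b : PrimeSpectrum Γ(X, U)) :
      (show X from hU.fromSpec a) ≤ (show X from hU.fromSpec b) ↔ b ≤ a :=
    (hU.fromSpec.isOpenEmbedding.isInducing.specializes_iff (x := b) (y := a)).trans
      (PrimeSpectrum.le_iff_specializes b a).symm
  have hmem (a : Zᵒᵈ) : (show X from hU.fromSpec (OrderDual.ofDual a).1) ≤ x := by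
    have h := (hle (OrderDual.ofDual a).1 (hU.primeIdealOf ⟨x, hx⟩)).2
      (OrderDual.ofDual a).2
    exact h.trans_eq (hU.fromSpec_primeIdealOf ⟨x, hx⟩)
  refine Order.krullDim_le_of_strictMono (α := Zᵒᵈ)
    (fun a => (⟨hU.fromSpec (OrderDual.ofDual a).1, hmem a⟩ : Set.Iic x)) fun a b hab => ?_
  have hab' : (OrderDual.ofDual b).1 < (OrderDual.ofDual a).1 := hab
  change (show X from hU.fromSpec (OrderDual.ofDual a).1) <
    (show X from hU.fromSpec (OrderDual.ofDual b).1)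
  rw [lt_iff_le_not_ge, hle, hle]
  exact ⟨hab'.le, hab'.not_ge⟩

/-- An integral scheme locally of finite type over a field has finite dimension `d`, and its points
of codimension one have dimension `d - 1`. -/
theorem exists_height_genericPoint [IsIntegral X]
    (p : X ⟶ Spec (CommRingCat.of k)) [LocallyOfFiniteType p] :
    ∃ d : ℕ, Order.height (genericPoint X) = d ∧
      ∀ x : X, Order.coheight x = 1 → Order.height x + 1 = d := by
  obtain ⟨d, hd⟩ := exists_ringKrullDim_sections_eq p
  have hco (x : X) : Order.coheight x ≤ d := by
    obtain ⟨U, hU, hx⟩ := exists_isAffineOpen_mem x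
    have : Nonempty U := ⟨⟨x, hx⟩⟩
    have h := Ideal.height_le_ringKrullDim_of_ne_top (I := (hU.primeIdealOf ⟨x, hx⟩).asIdeal)
      Ideal.IsPrime.ne_top'
    rw [(hd U hU this).1, ← coheight_eq_height_primeIdealOf] at h
    exact_mod_cast h
  have hle : Order.height (genericPoint X) ≤ d :=
    Order.height_le fun q _ => Order.length_le_coheight_head.trans (hco q.head)
  have key (x : X) (hx : Order.coheight x = 1) : (d : ℕ∞) ≤ Order.height x + 1 ∧
      Order.height x + 1 ≤ Order.height (genericPoint X) := by
    refine ⟨?_, Order.height_add_one_le ?_⟩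
    · obtain ⟨U, hU, hxU⟩ := exists_isAffineOpen_mem x
      have h := (hd U hU ⟨⟨x, hxU⟩⟩).2 _ (hU.primeIdealOf ⟨x, hxU⟩).isPrime
        ((coheight_eq_height_primeIdealOf hU x hxU).symm.trans hx)
      have h' := h.trans (add_le_add_left (ringKrullDim_quotient_le_height hU x hxU) 1)
      exact_mod_cast h'
    · have h : ¬ IsMax x := by
        rw [← Order.coheight_ne_zero, hx]
        exact one_ne_zero
      exact lt_of_le_not_ge (genericPoint_specializes x) fun h' => h fun y _ =>
        (show y ≤ genericPoint X from genericPoint_specializes y).trans h'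
  by_cases hne : ∃ x : X, Order.coheight x = 1
  · obtain ⟨x₀, h₀⟩ := hne
    have heq : Order.height (genericPoint X) = d :=
      le_antisymm hle ((key x₀ h₀).1.trans (key x₀ h₀).2)
    exact ⟨d, heq, fun x hx => le_antisymm ((key x hx).2.trans hle) (key x hx).1⟩
  · obtain ⟨e, he⟩ := ENat.ne_top_iff_exists.1 (hle.trans_lt (ENat.natCast_lt_top d)).ne
    exact ⟨e, he.symm, fun x hx => (hne ⟨x, hx⟩).elim⟩

end Heights

/-! ### Generic residue degree one -/

section Birational

variable {X Y : Scheme.{u}} [IsIntegral X] (f : X ⟶ Y)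

theorem functionFieldMap_surjective [IsIntegral Y]
    (h : f (genericPoint X) = genericPoint Y)
    (hs : Function.Surjective (f.stalkMap (genericPoint X)).hom) :
    Function.Surjective (functionFieldMap f h).hom := by
  have h1 : Function.Surjective (Y.presheaf.stalkSpecializes (specializes_of_eq h)).hom :=
    (Y.presheaf.stalkCongr (.of_eq h.symm)).commRingCatIsoToRingEquiv.surjective
  exact hs.comp h1

/-- The local ring at the generic point is its own residue field. -/
theorem stalkMap_genericPoint_surjective (h : f.residueDegree (genericPoint X) = 1) :
    Function.Surjective (f.stalkMap (genericPoint X)).hom := by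
  have hres : Function.Surjective (f.residueFieldMap (genericPoint X)).hom := by
    let _ := (f.residueFieldMap (genericPoint X)).hom.toAlgebra
    have h' : Module.finrank (Y.residueField (f (genericPoint X)))
      (X.residueField (genericPoint X)) = 1 := h
    intro w
    obtain ⟨c, hc⟩ := (finrank_eq_one_iff_of_nonzero' (1 : X.residueField (genericPoint X))
      one_ne_zero).1 h' w
    exact ⟨c, by rw [← hc, Algebra.smul_def, mul_one]; rfl⟩
  have hinj : Function.Injective (X.residue (genericPoint X)).hom :=
    RingHom.injective (R := X.functionField) _
  intro t
  obtain ⟨c, hc⟩ := hres ((X.residue _).hom t)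
  obtain ⟨s, rfl⟩ := Y.residue_surjective _ c
  refine ⟨s, hinj ?_⟩
  rw [← hc]
  exact (DFunLike.congr_fun
    (CommRingCat.hom_ext_iff.mp (Scheme.residue_residueFieldMap f _)) s).symm

end Birational

/-! ### Principal divisors and rational equivalence in codimension at most one -/

section Order

variable {X : Scheme.{u}} [IsIntegral X]

theorem eq_genericPoint_of_height_eq {x : X} (h : Order.height x = Order.height (genericPoint X))
    (hfin : Order.height (genericPoint X) ≠ ⊤) : x = genericPoint X := by
  by_contra hne
  have hlt : x < genericPoint X := by
    refine lt_of_le_not_ge (genericPoint_specializes x) fun h' => hne ?_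
    exact ((genericPoint_specializes x).antisymm h').symm.eq
  exact (Order.height_strictMono hlt (h ▸ hfin.lt_top)).ne h

theorem isIso_of_isClosedImmersion_of_genericPoint {V : Scheme.{u}} (i : V ⟶ X)
    [IsClosedImmersion i] (v : V) (h : i v = genericPoint X) : IsIso i := by
  have : Surjective i := by
    refine ⟨fun x => ?_⟩
    have hc : IsClosed (Set.range i) := i.isClosedEmbedding.isClosed_range
    exact ((genericPoint_specializes x).mem_closed hc ⟨v, h⟩)
  exact isIso_of_isClosedImmersion_of_surjective i

/-- Principal divisors can be transported along isomorphisms. -/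
theorem exists_ord_eq_of_isIso {V : Scheme.{u}} [IsIntegral V] [IsLocallyNoetherian X]
    [IsLocallyNoetherian V] (i : V ⟶ X) [IsIso i] (φ : V.functionField) (hφ : φ ≠ 0) :
    ∃ ψ : X.functionField, ψ ≠ 0 ∧ ∀ v : V, Scheme.ord ψ (i v) = Scheme.ord φ v := by
  have h : i (genericPoint V) = genericPoint X := genericPoint_eq_of_isOpenImmersion i
  obtain ⟨ψ, rfl⟩ := functionFieldMap_surjective i h
    (asIso (i.stalkMap (genericPoint V))).commRingCatIsoToRingEquiv.surjective φ
  have hψ : ψ ≠ 0 := fun h0 => hφ (by rw [h0, map_zero])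
  refine ⟨ψ, hψ, fun v => ?_⟩
  by_cases hv : Order.coheight v = 1
  · have hv' : Order.coheight (i v) = 1 := (coheight_eq_of_isOpenImmersion i).trans hv
    rw [Scheme.ord_eq_ordHom_of_coheight_eq_one hv, Scheme.ord_eq_ordHom_of_coheight_eq_one hv']
    congr 2
    have := krullDimLE_of_coheight_le hv.le
    have := krullDimLE_of_coheight_le hv'.le
    exact (ordFrac_ringEquiv (asIso (i.stalkMap v)).commRingCatIsoToRingEquiv
      (functionFieldMap i h).hom (functionFieldMap_algebraMap i h v) ψ).symm
  · have hv' : ¬ Order.coheight (i v) = 1 := by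
      rwa [show Order.coheight (i v) = Order.coheight v from coheight_eq_of_isOpenImmersion i]
    rw [Scheme.ord_eq_zero_of_coheight_neq_one hv, Scheme.ord_eq_zero_of_coheight_neq_one hv']

/-- A cycle of codimension one which is rationally equivalent to zero is the divisor of a single
rational function: the only integral closed subscheme of full dimension is `X` itself. -/
theorem exists_eq_ord_of_mem_ratEquivZero [IsLocallyNoetherian X] {r : ℕ}
    (hr : Order.height (genericPoint X) = (r + 1 : ℕ)) {c : cycles X r}
    (hc : c ∈ ratEquivZero X r) :
    ∃ φ : X.functionField, φ ≠ 0 ∧ ∀ x : X, c.1 x = Scheme.ord φ x := by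
  induction hc using AddSubgroup.closure_induction with
  | mem c hc =>
    obtain ⟨V, _, _, i, _, φ, hV, hφ, hdiv⟩ := hc
    have hgen := eq_genericPoint_of_height_eq (hV.trans hr.symm)
      (by rw [hr]; exact ENat.natCast_ne_top _)
    have := isIso_of_isClosedImmersion_of_genericPoint i _ hgen
    obtain ⟨ψ, hψ, h⟩ := exists_ord_eq_of_isIso i φ hφ
    refine ⟨ψ, hψ, fun x => ?_⟩
    obtain ⟨v, rfl⟩ := i.surjective x
    rw [hdiv.1, h]
  | zero =>
    refine ⟨1, one_ne_zero, fun x => ?_⟩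
    have h := Scheme.ord_mul (x := x) (one_ne_zero (α := X.functionField)) one_ne_zero
    rw [mul_one] at h
    change (0 : ℤ) = _
    linarith
  | add a b _ _ ha hb =>
    obtain ⟨φ, hφ, h⟩ := ha
    obtain ⟨ψ, hψ, h'⟩ := hb
    refine ⟨φ * ψ, mul_ne_zero hφ hψ, fun x => ?_⟩
    rw [Scheme.ord_mul hφ hψ, ← h, ← h']
    rfl
  | neg a _ ha =>
    obtain ⟨φ, hφ, h⟩ := ha
    refine ⟨φ⁻¹, inv_ne_zero hφ, fun x => ?_⟩
    have h1 := Scheme.ord_mul (x := x) (one_ne_zero (α := X.functionField)) one_ne_zero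
    have h2 := Scheme.ord_mul (x := x) hφ (inv_ne_zero hφ)
    rw [mul_inv_cancel₀ hφ] at h2
    rw [mul_one] at h1
    change -(a.1 x) = _
    rw [h]
    linarith

/-- In top dimension rational equivalence is trivial, for want of subschemes of larger dimension. -/
theorem ratEquivZero_eq_bot {r : ℕ} (hr : Order.height (genericPoint X) = r) :
    ratEquivZero X r = ⊥ := by
  refine AddSubgroup.closure_eq_bot_iff.2 ?_
  rintro c ⟨V, _, _, i, _, φ, hV, -⟩
  have h : Order.height (i (genericPoint V)) ≤ Order.height (genericPoint X) :=
    Order.height_mono (genericPoint_specializes _)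
  rw [hV, hr] at h
  have : r + 1 ≤ r := by exact_mod_cast h
  omega

end Order

/-! ### Cycles of integral closed subschemes -/

section Cycles

variable {X Y : Scheme.{u}}

open Classical in
/-- The cycle `[V]` of the integral closed subscheme with generic point `x`. -/
noncomputable def primeCycle (x : X) {r : ℕ} (hx : Order.height x = r) : cycles X r :=
  ⟨Function.locallyFinsuppWithin.single x 1, fun y hy => by
    rw [Function.locallyFinsuppWithin.single_apply] at hy
    split_ifs at hy with h
    · rw [h, hx]
    · exact (hy rfl).elim⟩

theorem primeCycle_apply_self (x : X) {r : ℕ} (hx : Order.height x = r) :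
    (primeCycle x hx).1 x = 1 := by
  classical
  change Function.locallyFinsuppWithin.single x (1 : ℤ) x = 1
  rw [Function.locallyFinsuppWithin.single_apply, if_pos rfl]

theorem primeCycle_apply_of_ne {x y : X} {r : ℕ} (hx : Order.height x = r) (h : y ≠ x) :
    (primeCycle x hx).1 y = 0 := by
  classical
  change Function.locallyFinsuppWithin.single x (1 : ℤ) y = 0
  rw [Function.locallyFinsuppWithin.single_apply, if_neg h]

theorem primeCycle_ne_zero (x : X) {r : ℕ} (hx : Order.height x = r) : primeCycle x hx ≠ 0 := by
  intro h
  have := primeCycle_apply_self x hx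
  rw [h] at this
  exact zero_ne_one this

variable (f : X ⟶ Y) [IsProper f]

theorem pushCycles_primeCycle_eq_zero (x : X) {r : ℕ} (hx : Order.height x = r)
    (h : Order.height x ≠ Order.height (f x)) : pushCycles f r (primeCycle x hx) = 0 := by
  refine Subtype.ext (Function.locallyFinsuppWithin.ext fun y => ?_)
  change pushCycle f (primeCycle x hx).1 y = 0
  rw [pushCycle_apply]
  refine finsum_mem_eq_zero_of_forall_eq_zero fun z _ => ?_
  by_cases hz : z = x
  · rw [hz, if_neg h, Nat.cast_zero, mul_zero]
  · rw [primeCycle_apply_of_ne hx hz, zero_mul]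

/-- This holds also where `chowPushforward f r` is zero by convention: an injective zero map has a
trivial source. -/
theorem mem_ratEquivZero_of_pushCycles_eq_zero {r : ℕ}
    (hf : Function.Injective (chowPushforward f r)) {c : cycles X r} (hc : pushCycles f r c = 0) :
    c ∈ ratEquivZero X r := by
  rw [← QuotientAddGroup.eq_zero_iff]
  apply hf
  rw [map_zero, chowPushforward]
  split_ifs with h
  · change QuotientAddGroup.map _ _ (pushCycles f r) h (QuotientAddGroup.mk c) = 0
    rw [QuotientAddGroup.map_mk, hc]
    rfl
  · rfl

end Cycles

/-! ### Pushforward of the fundamental class -/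

section FundamentalClass

variable {X Y : Scheme.{u}} (f : X ⟶ Y) [IsProper f]

theorem exists_pushCycles_eq_of_surjective {r : ℕ} (hX : ratEquivZero X r = ⊥)
    (hY : ratEquivZero Y r = ⊥) (hf : Function.Surjective (chowPushforward f r)) (c : cycles Y r) :
    ∃ a : cycles X r, pushCycles f r a = c := by
  obtain ⟨q, hq⟩ := hf (QuotientAddGroup.mk c)
  obtain ⟨a, rfl⟩ := QuotientAddGroup.mk_surjective q
  have h : ratEquivZero X r ≤ (ratEquivZero Y r).comap (pushCycles f r) := hX ▸ bot_le
  rw [chowPushforward, dif_pos h] at hq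
  change QuotientAddGroup.map _ _ (pushCycles f r) h (QuotientAddGroup.mk a) = _ at hq
  rw [QuotientAddGroup.map_mk] at hq
  have := QuotientAddGroup.eq.1 hq
  rw [hY, AddSubgroup.mem_bot] at this
  exact ⟨a, neg_add_eq_zero.1 this⟩

/-- If the pushforward on Chow groups is bijective, then `f` is generically finite of degree one:
`f_* [X] ≠ 0` gives `dim X ≤ dim Y`, a class with pushforward `[Y]` gives `dim Y ≤ dim X`, and then
`f_* (n • [X]) = [Y]` forces the degree to be one. -/
theorem map_genericPoint_and_residueDegree_eq_one [IsIntegral X] [IsIntegral Y] {dX dY : ℕ}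
    (hdX : Order.height (genericPoint X) = dX) (hdY : Order.height (genericPoint Y) = dY)
    (hf : ∀ r, Function.Bijective (chowPushforward f r)) :
    dX = dY ∧ f (genericPoint X) = genericPoint Y ∧ f.residueDegree (genericPoint X) = 1 := by
  have h1 : Order.height (genericPoint X) = Order.height (f (genericPoint X)) := by
    by_contra hne
    have h := mem_ratEquivZero_of_pushCycles_eq_zero f (hf dX).1
      (pushCycles_primeCycle_eq_zero f _ hdX hne)
    rw [ratEquivZero_eq_bot hdX, AddSubgroup.mem_bot] at h
    exact primeCycle_ne_zero _ _ h
  have hle : dX ≤ dY := by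
    have h : Order.height (f (genericPoint X)) ≤ Order.height (genericPoint Y) :=
      Order.height_mono (genericPoint_specializes _)
    rw [← h1, hdX, hdY] at h
    exact_mod_cast h
  have hge : dY ≤ dX := by
    obtain ⟨q, hq⟩ := (hf dY).2 (QuotientAddGroup.mk (primeCycle (genericPoint Y) hdY))
    obtain ⟨a, rfl⟩ := QuotientAddGroup.mk_surjective q
    by_contra hlt
    have ha : a = 0 := by
      refine Subtype.ext (Function.locallyFinsuppWithin.ext fun x => ?_)
      by_contra hx
      have h : Order.height x ≤ Order.height (genericPoint X) :=
        Order.height_mono (genericPoint_specializes _)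
      rw [a.2 x hx, hdX] at h
      exact hlt (by exact_mod_cast h)
    rw [ha] at hq
    have h := (map_zero (chowPushforward f dY)).symm.trans hq
    have h' := (QuotientAddGroup.eq_zero_iff _).1 h.symm
    rw [ratEquivZero_eq_bot hdY, AddSubgroup.mem_bot] at h'
    exact primeCycle_ne_zero _ _ h'
  obtain rfl : dX = dY := le_antisymm hle hge
  have hgen : f (genericPoint X) = genericPoint Y :=
    eq_genericPoint_of_height_eq (by rw [← h1, hdX, hdY]) (by rw [hdY]; exact ENat.natCast_ne_top _)
  refine ⟨rfl, hgen, ?_⟩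
  obtain ⟨a, ha⟩ := exists_pushCycles_eq_of_surjective f (ratEquivZero_eq_bot hdX)
    (ratEquivZero_eq_bot hdY) (hf dX).2 (primeCycle (genericPoint Y) hdY)
  have h2 : pushCycle f a.1 (genericPoint Y) = 1 := by
    rw [← primeCycle_apply_self (genericPoint Y) hdY, ← ha]
    rfl
  rw [pushCycle_apply, finsum_eq_single _ (genericPoint X)] at h2
  · classical
    rw [finsum_eq_if, if_pos (by exact hgen), if_pos h1] at h2
    have := Int.isUnit_iff.1 (IsUnit.of_mul_eq_one_right _ h2)
    omega
  · intro x hx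
    have : a.1 x = 0 := by
      by_contra hne
      exact hx (eq_genericPoint_of_height_eq ((a.2 x hne).trans hdX.symm)
        (by rw [hdX]; exact ENat.natCast_ne_top _))
    rw [this, zero_mul, finsum_zero]

end FundamentalClass

/-! ### Prime divisors under birational morphisms -/

section Divisors

variable {k : Type u} [Field k] {X Y : Scheme.{u}} (f : X ⟶ Y)

theorem coheight_le_one_of_height [IsIntegral Y] {y : Y} {d : ℕ}
    (hd : Order.height (genericPoint Y) = d)
    (hy : Order.height y + 1 = d) : Order.coheight y ≤ 1 := by
  rw [← Nat.cast_one, Order.coheight_le_coe_iff]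
  intro z hz
  have hle : Order.height z ≤ Order.height (genericPoint Y) :=
    Order.height_mono (genericPoint_specializes _)
  have hge := Order.height_add_one_le hz
  rw [hy, ← hd] at hge
  rw [eq_genericPoint_of_height_eq (le_antisymm hle hge) (by rw [hd]; exact ENat.natCast_ne_top _)]
  have h0 : Order.coheight (genericPoint Y) = 0 := Order.coheight_top Y
  rw [h0]
  exact_mod_cast Nat.zero_lt_one

/-- A birational morphism to a smooth scheme is a local isomorphism at all points over points of
codimension one, where the local rings of the target are discrete valuation rings. -/
theorem stalkMap_bijective_of_coheight_eq_one [IsIntegral X] [IsIntegral Y]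
    [IsLocallyNoetherian Y] (q : Y ⟶ Spec (CommRingCat.of k)) [Smooth q]
    (h : f (genericPoint X) = genericPoint Y)
    (hs : Function.Surjective (functionFieldMap f h).hom) (x : X)
    (hx : Order.coheight (f x) = 1) : Function.Bijective (f.stalkMap x).hom := by
  have := isDiscreteValuationRing_stalk q (f x) hx
  exact bijective_of_isLocalHom_of_valuationRing (f.stalkMap x).hom (functionFieldMap f h).hom hs
    (functionFieldMap_algebraMap f h x)

theorem coheight_eq_of_stalkMap_bijective (x : X) (h : Function.Bijective (f.stalkMap x).hom) :
    Order.coheight x = Order.coheight (f x) := by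
  have e := ringKrullDim_eq_of_ringEquiv (RingEquiv.ofBijective (f.stalkMap x).hom h)
  rw [ringKrullDim_stalk_eq_coheight, ringKrullDim_stalk_eq_coheight] at e
  exact_mod_cast e.symm

theorem surjective_of_map_genericPoint [IsIntegral X] [IsIntegral Y] [IsProper f]
    (h : f (genericPoint X) = genericPoint Y) :
    Function.Surjective f := by
  intro y
  have hc : IsClosed (Set.range f) := f.isClosedMap.isClosed_range
  exact (genericPoint_specializes y).mem_closed hc ⟨_, h⟩

/-- A rational function whose pullback has order zero at a point `x` over a point of codimension one
is regular at `f x`. -/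
theorem exists_algebraMap_eq_of_ord_eq_zero [IsIntegral X] [IsIntegral Y]
    [IsLocallyNoetherian X] [IsLocallyNoetherian Y] (q : Y ⟶ Spec (CommRingCat.of k)) [Smooth q]
    (h : f (genericPoint X) = genericPoint Y)
    (hs : Function.Surjective (functionFieldMap f h).hom)
    {ψ : Y.functionField} (hψ : ψ ≠ 0) (x : X) (hx : Order.coheight (f x) = 1)
    (h0 : Scheme.ord ((functionFieldMap f h).hom ψ) x = 0) :
    ∃ t, algebraMap (Y.presheaf.stalk (f x)) Y.functionField t = ψ := by
  have hb := stalkMap_bijective_of_coheight_eq_one f q h hs x hx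
  have := isDiscreteValuationRing_stalk q (f x) hx
  have hx' := (coheight_eq_of_stalkMap_bijective f x hb).trans hx
  have := krullDimLE_of_coheight_le hx.le
  have := krullDimLE_of_coheight_le hx'.le
  have hne : (functionFieldMap f h).hom ψ ≠ 0 := by
    rwa [map_ne_zero_iff _ (functionFieldMap f h).hom.injective]
  rw [Scheme.ord_eq_iff hx' hne] at h0
  have e := ordFrac_ringEquiv (RingEquiv.ofBijective (f.stalkMap x).hom hb)
      (functionFieldMap f h).hom (functionFieldMap_algebraMap f h x) ψ
  obtain ⟨t, -, ht⟩ := exists_isUnit_algebraMap_eq_of_ordFrac_eq_one (e.symm.trans h0)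
  exact ⟨t, ht⟩

/-- Suppose that the divisor of `φ` is supported exactly on the closure of `x`. Then a proper
birational morphism to a smooth variety does not contract this closure. Otherwise `φ` and `φ⁻¹`
would be regular in codimension one on the target, hence `φ` would be a unit near `f x` by Hartogs,
and its order at `x` would be zero. -/
theorem coheight_map_eq_one_of_ord [IsIntegral X] [IsIntegral Y]
    [IsLocallyNoetherian X] [IsLocallyNoetherian Y] [IsProper f]
    (q : Y ⟶ Spec (CommRingCat.of k)) [Smooth q]
    (h : f (genericPoint X) = genericPoint Y)
    (hs : Function.Surjective (functionFieldMap f h).hom) (x : X)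
    (φ : X.functionField) (hφ : φ ≠ 0) (h1 : Scheme.ord φ x ≠ 0)
    (h0 : ∀ z, z ≠ x → Scheme.ord φ z = 0) : Order.coheight (f x) = 1 := by
  by_contra hx
  obtain ⟨ψ, rfl⟩ := hs φ
  have hψ : ψ ≠ 0 := fun h0 => hφ (by rw [h0, map_zero])
  obtain ⟨W, hW, hxW⟩ := exists_isAffineOpen_mem (f x)
  have : Nonempty W := ⟨⟨_, hxW⟩⟩
  have : Nonempty (f ⁻¹ᵁ W) := ⟨⟨x, hxW⟩⟩
  have := isIntegrallyClosed_sections q hW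
  have key (ψ : Y.functionField) (hψ : ψ ≠ 0)
      (h0 : ∀ z, z ≠ x → Scheme.ord ((functionFieldMap f h).hom ψ) z = 0) :
      ∃ a, Y.germToFunctionField W a = ψ := by
    refine exists_germToFunctionField_eq hW ψ fun y _ hy => ?_
    obtain ⟨z, rfl⟩ := surjective_of_map_genericPoint f h y
    exact exists_algebraMap_eq_of_ord_eq_zero f q h hs hψ z hy
      (h0 z fun hzx => hx (hzx ▸ hy))
  obtain ⟨a, ha⟩ := key ψ hψ h0
  obtain ⟨b, hb⟩ := key ψ⁻¹ (inv_ne_zero hψ) fun z hz => by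
    have h1 := Scheme.ord_mul (x := z) (one_ne_zero (α := X.functionField)) one_ne_zero
    have hne := (map_ne_zero_iff _ (functionFieldMap f h).hom.injective).2 (inv_ne_zero hψ)
    have h2 := Scheme.ord_mul (x := z) hφ hne
    rw [← map_mul, mul_inv_cancel₀ hψ, map_one, h0 z hz] at h2
    rw [mul_one] at h1
    linarith
  have hab : a * b = 1 := by
    apply Y.germToFunctionField_injective W
    rw [map_mul, map_one, ha, hb, mul_inv_cancel₀ hψ]
  refine h1 ?_
  rw [← ha, functionFieldMap_germToFunctionField]
  exact Scheme.ord_of_isUnit ((IsUnit.of_mul_eq_one b hab).map (f.app W).hom) hxW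

end Divisors

/-! ### From codimension one to isomorphisms -/

section Isomorphism

variable {X Y : Scheme.{u}} [IsIntegral X] [IsIntegral Y] (f : X ⟶ Y)

/-- A birational morphism of smooth schemes which is a local isomorphism at all points of
codimension one of the source is unramified. -/
theorem formallyUnramified_of_stalkMap_surjective {k : Type u} [Field k] [IsLocallyNoetherian X]
    (q : Y ⟶ Spec (CommRingCat.of k)) [Smooth q] [Smooth (f ≫ q)]
    (h : f (genericPoint X) = genericPoint Y)
    (hs : Function.Surjective (functionFieldMap f h).hom)
    (hf : ∀ x, Order.coheight x = 1 → Function.Surjective (f.stalkMap x).hom) :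
    FormallyUnramified f := by
  rw [HasRingHomProperty.iff_appLE (P := @FormallyUnramified)]
  intro U V e
  by_cases hV : Nonempty V.1
  swap
  · have : Subsingleton Γ(X, V.1) := by
      rw [show V.1 = ⊥ from (TopologicalSpace.Opens.not_nonempty_iff_eq_bot _).1
        fun ⟨x, hx⟩ => hV ⟨⟨x, hx⟩⟩]
      infer_instance
    exact RingHom.FormallyUnramified.of_surjective fun b => ⟨0, Subsingleton.elim _ _⟩
  have hU : Nonempty U.1 := by
    obtain ⟨x, hx⟩ := hV
    exact ⟨⟨f x, e hx⟩⟩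
  let _ : Algebra k Γ(Y, U.1) := (sectionsMap q U.1).hom.toAlgebra
  let _ : Algebra k Γ(X, V.1) := (sectionsMap (f ≫ q) V.1).hom.toAlgebra
  let _ : Algebra Γ(Y, U.1) Γ(X, V.1) := (f.appLE U V e).hom.toAlgebra
  let _ : Algebra k X.functionField :=
    ((X.germToFunctionField V.1).hom.comp (sectionsMap (f ≫ q) V.1).hom).toAlgebra
  let _ : Algebra Γ(Y, U.1) X.functionField :=
    ((X.germToFunctionField V.1).hom.comp (f.appLE U V e).hom).toAlgebra
  have : Algebra.Smooth k Γ(Y, U.1) := sectionsMap_smooth q U.2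
  have : Algebra.Smooth k Γ(X, V.1) := sectionsMap_smooth (f ≫ q) V.2
  have hk : (f.appLE U V e).hom.comp (sectionsMap q U.1).hom = (sectionsMap (f ≫ q) V.1).hom :=
    CommRingCat.hom_ext_iff.mp (sectionsMap_comp q f U V e)
  have : IsScalarTower k Γ(Y, U.1) Γ(X, V.1) := .of_algebraMap_eq' hk.symm
  have : IsScalarTower Γ(Y, U.1) Γ(X, V.1) X.functionField := .of_algebraMap_eq' rfl
  have : IsScalarTower k Γ(X, V.1) X.functionField := .of_algebraMap_eq' rfl
  have : IsScalarTower k Γ(Y, U.1) X.functionField := .of_algebraMap_eq' <| by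
    change (X.germToFunctionField V.1).hom.comp (sectionsMap (f ≫ q) V.1).hom =
      ((X.germToFunctionField V.1).hom.comp (f.appLE U V e).hom).comp (sectionsMap q U.1).hom
    rw [RingHom.comp_assoc, hk]
  have := functionField_isFractionRing_of_isAffineOpen X V.1 V.2
  have := functionField_isFractionRing_of_isAffineOpen Y U.1 U.2
  have : IsFractionRing Γ(Y, U.1) X.functionField :=
    IsLocalization.isLocalization_of_algEquiv (nonZeroDivisors Γ(Y, U.1))
      (AlgEquiv.ofRingEquiv (f := RingEquiv.ofBijective (functionFieldMap f h).hom
        ⟨(functionFieldMap f h).hom.injective, hs⟩)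
        (functionFieldMap_germ f h U.1 V.1 e))
  have : IsNoetherianRing Γ(X, V.1) := IsLocallyNoetherian.component_noetherian V
  have := isIntegrallyClosed_sections (f ≫ q) V.2
  refine formallyUnramified_of_height_one (k := k) X.functionField fun p hp hp1 b => ?_
  obtain ⟨x, hx, hx1, hxp⟩ := exists_point_of_isPrime V.2 p
  obtain ⟨t, ht⟩ := hf x (hx1.trans hp1) (X.presheaf.germ V.1 x hx b)
  obtain ⟨s, a, hsu, hsa⟩ := exists_germ_mul_eq U.2 (f x) (e hx) t
  have hg (c : Γ(Y, U.1)) : (f.stalkMap x).hom (Y.presheaf.germ U.1 (f x) (e hx) c) =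
      X.presheaf.germ V.1 x hx ((f.appLE U V e).hom c) :=
    (Scheme.Hom.germ_stalkMap_apply f U.1 x (e hx) c).trans
      (X.presheaf.germ_res_apply (homOfLE e) _ _ _).symm
  refine ⟨s, a, ?_, ?_⟩
  · have h1 := hsu.map (f.stalkMap x).hom
    rw [hg, isUnit_germ_iff V.2, hxp] at h1
    exact h1
  · apply germ_injective_of_isIntegral X x hx
    have h1 := congrArg (f.stalkMap x).hom hsa
    rw [map_mul, hg, hg, ht] at h1
    rw [map_mul]
    exact h1

theorem locallyQuasiFinite_of_formallyUnramified {X Y : Scheme.{u}} (f : X ⟶ Y)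
    [FormallyUnramified f] [LocallyOfFiniteType f] : LocallyQuasiFinite f := by
  rw [HasRingHomProperty.iff_appLE (P := @LocallyQuasiFinite)]
  intro U V e
  let _ : Algebra Γ(Y, U.1) Γ(X, V.1) := (f.appLE U V e).hom.toAlgebra
  have : Algebra.FiniteType Γ(Y, U.1) Γ(X, V.1) := f.finiteType_appLE U.2 V.2 e
  have : Algebra.FormallyUnramified Γ(Y, U.1) Γ(X, V.1) := f.formallyUnramified_appLE U.2 V.2 e
  exact (inferInstance : Algebra.QuasiFinite Γ(Y, U.1) Γ(X, V.1))

/-- A finite birational morphism onto a normal scheme is an isomorphism. -/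
theorem isIso_of_isIntegralHom_of_functionFieldMap_surjective [IsIntegralHom f]
    (hn : ∀ W : Y.Opens, IsAffineOpen W → Nonempty W → IsIntegrallyClosed Γ(Y, W))
    (h : f (genericPoint X) = genericPoint Y)
    (hs : Function.Surjective (functionFieldMap f h).hom) : IsIso f := by
  refine (IsZariskiLocalAtTarget.iff_of_iSup_eq_top (P := .isomorphisms Scheme)
    (fun W : Y.affineOpens => W.1) (iSup_affineOpens_eq_top Y)).2 fun W => ?_
  refine (isIso_morphismRestrict_iff_isIso_app f W.2).2 ?_
  rw [ConcreteCategory.isIso_iff_bijective]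
  by_cases hW : Nonempty W.1
  swap
  · have hbot : W.1 = ⊥ := (TopologicalSpace.Opens.not_nonempty_iff_eq_bot _).1
        fun ⟨x, hx⟩ => hW ⟨⟨x, hx⟩⟩
    have : Subsingleton Γ(Y, W.1) := by
      rw [hbot]
      infer_instance
    have : Subsingleton Γ(X, f ⁻¹ᵁ W.1) := by
      rw [hbot]
      exact inferInstanceAs (Subsingleton Γ(X, ⊥))
    exact ⟨fun _ _ _ => Subsingleton.elim _ _, fun b => ⟨0, Subsingleton.elim _ _⟩⟩
  have : Nonempty (f ⁻¹ᵁ W.1) := by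
    have hmem : f (genericPoint X) ∈ W.1 := by
      rw [h]
      exact ((genericPoint_spec Y).mem_open_set_iff W.1.isOpen).2 (by simpa using hW)
    exact ⟨⟨genericPoint X, hmem⟩⟩
  have := hn W.1 W.2 hW
  have := functionField_isFractionRing_of_isAffineOpen Y W.1 W.2
  have hcomm := functionFieldMap_germToFunctionField f h W.1
  refine ⟨fun a b hab => ?_, fun b => ?_⟩
  · apply Y.germToFunctionField_injective W.1
    apply (functionFieldMap f h).hom.injective
    rw [hcomm, hcomm]
    exact congrArg _ hab
  · obtain ⟨ψ, hψ⟩ := hs (X.germToFunctionField (f ⁻¹ᵁ W.1) b)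
    have hint : IsIntegral Γ(Y, W.1) ψ := by
      obtain ⟨P, hP, hPb⟩ := f.isIntegral_app W.1 W.2 b
      refine ⟨P, hP, (functionFieldMap f h).hom.injective ?_⟩
      have h1 := congrArg (X.germToFunctionField (f ⁻¹ᵁ W.1)).hom hPb
      rw [Polynomial.hom_eval₂, map_zero] at h1
      rw [Polynomial.hom_eval₂, map_zero, hψ, ← h1]
      congr 1
      exact RingHom.ext hcomm
    obtain ⟨a, ha⟩ := IsIntegrallyClosed.isIntegral_iff.1 hint
    refine ⟨a, X.germToFunctionField_injective (f ⁻¹ᵁ W.1) ?_⟩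
    rw [← hψ, ← ha]
    exact (hcomm a).symm

end Isomorphism

/-! ### Bijective pushforward implies isomorphism -/

/-- A proper morphism of smooth integral `k`-schemes inducing bijections on all Chow groups is an
isomorphism. In view of `mem_ratEquivZero_of_pushCycles_eq_zero`, the value `0` that
`chowPushforward` takes when `pushCycles` does not respect rational equivalence needs no separate
treatment. -/
theorem isIso_of_chowPushforward_bijective {k : Type u} [Field k] {X Y : Scheme.{u}} [IsIntegral X]
    [IsIntegral Y] (f : X ⟶ Y) [IsProper f] (q : Y ⟶ Spec (CommRingCat.of k)) [Smooth q]
    [Smooth (f ≫ q)] (hf : ∀ r, Function.Bijective (chowPushforward f r)) : IsIso f := by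
  have : IsLocallyNoetherian Y := LocallyOfFiniteType.isLocallyNoetherian q
  have : IsLocallyNoetherian X := LocallyOfFiniteType.isLocallyNoetherian (f ≫ q)
  obtain ⟨dX, hdX, hX⟩ := exists_height_genericPoint (f ≫ q)
  obtain ⟨dY, hdY, -⟩ := exists_height_genericPoint q
  obtain ⟨rfl, hgen, hdeg⟩ := map_genericPoint_and_residueDegree_eq_one f hdX hdY hf
  have hs := functionFieldMap_surjective f hgen (stalkMap_genericPoint_surjective f hdeg)
  have hco (x : X) (hx : Order.coheight x = 1) : Order.coheight (f x) = 1 := by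
    obtain ⟨r, hr⟩ := ENat.ne_top_iff_exists.1
      (show Order.height x ≠ ⊤ from fun h => by simpa [h] using hX x hx)
    have hrd : r + 1 = dX := by
      have := hX x hx
      rw [← hr] at this
      exact_mod_cast this
    -- Either `x` is not contracted, and dimension theory applies, or its cycle is pushed forward to
    -- zero, hence is principal by injectivity.
    by_cases heq : Order.height x = Order.height (f x)
    · have hle := coheight_le_one_of_height hdY (heq ▸ hX x hx)
      refine le_antisymm hle (Order.one_le_iff_ne_zero.2 fun h0 => ?_)
      have hmax := Order.coheight_eq_zero.1 h0
      have hη : f x = genericPoint Y :=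
        ((genericPoint_specializes (f x)).antisymm
          (hmax (genericPoint_specializes (f x)))).eq.symm
      rw [hη, hdY, ← hr] at heq
      have : r = dX := by exact_mod_cast heq
      omega
    · have hmem := mem_ratEquivZero_of_pushCycles_eq_zero f (hf r).1
        (pushCycles_primeCycle_eq_zero f x hr.symm heq)
      obtain ⟨φ, hφ, hord⟩ := exists_eq_ord_of_mem_ratEquivZero (by rw [hdX, hrd]) hmem
      refine coheight_map_eq_one_of_ord f q hgen hs x φ hφ ?_ fun z hz => ?_
      · rw [← hord, primeCycle_apply_self]
        exact one_ne_zero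
      · rw [← hord, primeCycle_apply_of_ne _ hz]
  have := formallyUnramified_of_stalkMap_surjective f q hgen hs fun x hx =>
    (stalkMap_bijective_of_coheight_eq_one f q hgen hs x (hco x hx)).2
  have := locallyQuasiFinite_of_formallyUnramified f
  have := IsFinite.of_isProper_of_locallyQuasiFinite f
  exact isIso_of_isIntegralHom_of_functionFieldMap_surjective f
    (fun W hW _ => isIntegrallyClosed_sections q hW) hgen hs

end ChowWhitehead

/-- A morphism of smooth projective varieties over a field whose proper pushforward on total Chow
groups is an isomorphism is itself an isomorphism. -/
theorem theorem4p1 (k : Type u) [Field k] (X Y : Over (Spec (CommRingCat.of k)))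
    (hX : ChowWhitehead.IsSmoothProjectiveVariety k X)
    (hY : ChowWhitehead.IsSmoothProjectiveVariety k Y) (f : X ⟶ Y)
    (hf : haveI : IsProper f.left := ChowWhitehead.isProper_left hX hY f
      Function.Bijective (ChowWhitehead.pushforward f.left)) :
    IsIso f := by
  have : IsProper f.left := ChowWhitehead.isProper_left hX hY f
  have := hX.geometricallyIntegral
  have := hY.geometricallyIntegral
  have : IsIntegral X.left := GeometricallyIntegral.isIntegral_of_subsingleton X.hom
  have : IsIntegral Y.left := GeometricallyIntegral.isIntegral_of_subsingleton Y.hom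
  have := hY.smooth
  have : Smooth (f.left ≫ Y.hom) := by
    rw [Over.w f]
    exact hX.smooth
  have : IsIso f.left := ChowWhitehead.isIso_of_chowPushforward_bijective f.left Y.hom fun r =>
    ⟨(DirectSum.map_injective _).1 hf.1 r, (DirectSum.map_surjective _).1 hf.2 r⟩
  have : IsIso ((Over.forget _).map f) := this
  exact isIso_of_reflects_iso f (Over.forget _)
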